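/- A $(0,1)$-matrix $M$ of degree $n$ (that is, of size $n\times n$) is \emph{row-strongly quadrangular} if for every set $S$ of rows of $M$ such that each $u\in S$ has some $v\in S$, $v\neq u$ (as rows of $M$, i.e. with a different row index), with $\langle u,v\rangle\neq 0$, the number of columns that contain at least two ones in the rows of $S$ is at least $|S|$. It is \emph{strongly quadrangular} (SQ) if $M$ and $M^{T}$ are row-strongly quadrangular. Throughout, only SQ matrices without a zero row or a zero column are considered. The matrix $M$ is \emph{indecomposable} if it has no $r\times(n-r)$ zero submatrix with $1\le r\le n-1$, and \emph{regular} if all its row sums and all its column sums are equal to one number. Two matrices $M_1,M_2$ are \emph{equivalent} if $PM_1Q=M_2$ for some permutation matrices $P,Q$; the automorphism group $\mathrm{Aut}\,M$ consists of the pairs $(P,Q)$ of permutation matrices with $PMQ=M$. $M$ \emph{supports a unitary} if there is a complex unitary matrix whose nonzero entries are exactly at the ones of $M$. In the lists below a matrix is written by its rows, separated by bars; the subscript is $|\mathrm{Aut}\,M|$; the index R marks exactly the regular matrices, S exactly the matrices equivalent to a symmetric matrix, T exactly the matrices not equivalent to their transpose; matrices with the index N do not support unitaries. An entry with index T stands for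 two matrices, itself and its transpose. The following holds, with all printed data correct. (1) Every indecomposable SQ matrix of degree $n\le 5$, $n\geq 1$, is equivalent to exactly one matrix of the following list for $n$, and all matrices of the list are indecomposable SQ matrices. $n=1$: $[1]^{\mathrm{RS}}_{1}$. $n=2$: $[11\,|\,11]^{\mathrm{RS}}_{4}$. $n=3$: $[011\,|\,111\,|\,111]^{\mathrm{S}}_{4}$, $[111\,|\,111\,|\,111]^{\mathrm{RS}}_{36}$. $n=4$: $[0111\,|\,1111\,|\,1111\,|\,1111]^{\mathrm{S}}_{36}$, $[0111\,|\,1011\,|\,1111\,|\,1111]^{\mathrm{S}}_{8}$, $[0111\,|\,1011\,|\,1101\,|\,1111]^{\mathrm{S}}_{6}$, $[0111\,|\,1011\,|\,1101\,|\,1110]^{\mathrm{RS}}_{24}$, $[0011\,|\,0111\,|\,1111\,|\,1111]^{\mathrm{S}}_{4}$, $[0011\,|\,1111\,|\,1111\,|\,1111]^{\mathrm{T}}_{24}$, $[1011\,|\,0111\,|\,1011\,|\,0111]^{\mathrm{T}}_{16}$, $[1111\,|\,1111\,|\,1111\,|\,1111]^{\mathrm{RS}}_{576}$. $n=5$: $[01111\,|\,11111\,|\,11111\,|\,11111\,|\,11111]^{\mathrm{S}}_{576}$,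 $[01111\,|\,10111\,|\,11111\,|\,11111\,|\,11111]^{\mathrm{S}}_{72}$, $[01111\,|\,10111\,|\,11011\,|\,11111\,|\,11111]^{\mathrm{S}}_{24}$, $[01111\,|\,10111\,|\,11011\,|\,11101\,|\,11111]^{\mathrm{S}}_{24}$, $[01111\,|\,10111\,|\,11011\,|\,11101\,|\,11110]^{\mathrm{RS}}_{120}$, $[00011\,|\,00111\,|\,01111\,|\,11111\,|\,11111]^{\mathrm{S}}_{4}$, $[00011\,|\,01111\,|\,01111\,|\,11111\,|\,11111]^{\mathrm{S}}_{16}$, $[00011\,|\,01111\,|\,01111\,|\,11100\,|\,11100]^{\mathrm{S}}_{16}$, $[00111\,|\,01111\,|\,11111\,|\,11111\,|\,11111]^{\mathrm{S}}_{36}$, $[00111\,|\,01111\,|\,11011\,|\,11111\,|\,11111]^{\mathrm{S}}_{4}$, $[00111\,|\,01111\,|\,11011\,|\,11101\,|\,11111]^{\mathrm{S}}_{2}$, $[00111\,|\,01111\,|\,11011\,|\,11101\,|\,11110]^{\mathrm{S}}_{6}$, $[00111\,|\,00111\,|\,11111\,|\,11111\,|\,11111]^{\mathrm{S}}_{144}$,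 $[00111\,|\,00111\,|\,11011\,|\,11111\,|\,11111]^{\mathrm{S}}_{16}$, $[00111\,|\,00111\,|\,11011\,|\,11101\,|\,11111]^{\mathrm{NS}}_{8}$, $[00111\,|\,00111\,|\,11011\,|\,11101\,|\,11110]^{\mathrm{NS}}_{24}$, $[00111\,|\,01011\,|\,10111\,|\,11111\,|\,11111]^{\mathrm{S}}_{4}$, $[00111\,|\,01011\,|\,10111\,|\,11101\,|\,11111]^{\mathrm{S}}_{1}$, $[00111\,|\,01011\,|\,10111\,|\,11101\,|\,11110]^{\mathrm{S}}_{2}$, $[10011\,|\,01111\,|\,01111\,|\,11111\,|\,11111]^{\mathrm{S}}_{16}$, $[10011\,|\,01111\,|\,01111\,|\,11101\,|\,11111]^{\mathrm{S}}_{4}$, $[10011\,|\,01111\,|\,01111\,|\,11101\,|\,11110]^{\mathrm{S}}_{8}$, $[11111\,|\,11111\,|\,11111\,|\,11111\,|\,11111]^{\mathrm{RS}}_{14400}$, $[00111\,|\,11111\,|\,11111\,|\,11111\,|\,11111]^{\mathrm{T}}_{288}$, $[00011\,|\,11111\,|\,11111\,|\,11111\,|\,11111]^{\mathrm{T}}_{288}$,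 $[00011\,|\,01111\,|\,11111\,|\,11111\,|\,11111]^{\mathrm{T}}_{24}$, $[00011\,|\,01111\,|\,10111\,|\,11111\,|\,11111]^{\mathrm{T}}_{8}$, $[00011\,|\,01111\,|\,10111\,|\,11011\,|\,11111]^{\mathrm{T}}_{12}$, $[00011\,|\,11111\,|\,11111\,|\,11111\,|\,11100]^{\mathrm{T}}_{72}$, $[00011\,|\,01111\,|\,11111\,|\,11111\,|\,11100]^{\mathrm{T}}_{8}$, $[00011\,|\,01111\,|\,10111\,|\,11111\,|\,11100]^{\mathrm{T}}_{4}$, $[00011\,|\,01111\,|\,10111\,|\,11011\,|\,11100]^{\mathrm{T}}_{12}$, $[00111\,|\,01011\,|\,11111\,|\,11111\,|\,11111]^{\mathrm{T}}_{24}$, $[00111\,|\,01011\,|\,11101\,|\,11111\,|\,11111]^{\mathrm{T}}_{4}$, $[00111\,|\,01011\,|\,11101\,|\,11110\,|\,11111]^{\mathrm{T}}_{4}$, $[00011\,|\,01100\,|\,11111\,|\,11111\,|\,11111]^{\mathrm{T}}_{48}$, $[00111\,|\,11011\,|\,11111\,|\,11111\,|\,11111]^{\mathrm{T}}_{24}$,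 $[00111\,|\,11011\,|\,11101\,|\,11111\,|\,11111]^{\mathrm{T}}_{8}$, $[00111\,|\,11011\,|\,11101\,|\,11110\,|\,11111]^{\mathrm{T}}_{12}$, $[00011\,|\,11100\,|\,11100\,|\,11111\,|\,11111]^{\mathrm{T}}_{48}$, $[00011\,|\,00111\,|\,11111\,|\,11111\,|\,11111]^{\mathrm{T}}_{24}$, $[00011\,|\,00111\,|\,11000\,|\,11111\,|\,11111]^{\mathrm{T}}_{8}$, $[00011\,|\,01100\,|\,01111\,|\,11111\,|\,11111]^{\mathrm{T}}_{16}$. (2) Let $\sigma$ be the number of ones in each row of a regular matrix. Up to equivalence, the regular SQ matrices of degree $6$ are: for $\sigma=6,5,3,2,1$ only $J_6$, $J_6-I_6$, $J_3\oplus J_3$, $J_2\oplus J_2\oplus J_2$, $I_6$, respectively (where $J_k$ is the all-ones and $I_k$ the identity matrix), and for $\sigma=4$ the four pairwise inequivalent matrices $[100111\,|\,010111\,|\,001111\,|\,111100\,|\,111010\,|\,111001]^{\mathrm{RS}}_{72}$, $[001111\,|\,001111\,|\,110011\,|\,110011\,|\,111100\,|\,111100]^{\mathrm{RS}}_{384}$,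 $[111100\,|\,011110\,|\,001111\,|\,100111\,|\,110011\,|\,111001]^{\mathrm{RS}}_{12}$, $[001111\,|\,001111\,|\,111100\,|\,110110\,|\,110011\,|\,111001]^{\mathrm{NRS}}_{32}$. (3) The number of inequivalent indecomposable SQ matrices of degree $n=1,2,3,4,5$ is $1,1,2,10,63$, respectively; for these $n$ it equals the number of triples of standard Young tableaux with $n-1$ cells and the same shape, the shape having at most three rows. The number of inequivalent SQ matrices of degree $n=1,\dots,5$ is $1,2,4,15,80$. (4) The number of equivalence classes that contain a symmetric indecomposable SQ matrix of degree $n=1,\dots,5$ is $1,1,2,6,23$; the number of those that contain a symmetric SQ matrix is $1,2,4,11,36$. (5) The number of inequivalent indecomposable regular SQ matrices of degree $n=1,\dots,6$ is $1,1,1,2,2,6$; the number of inequivalent regular SQ matrices of degree $n=1,\dots,6$ is $1,2,2,4,3,9$. -/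

import Mathlib

/-!
Square (0,1)-matrices are matrices over `ℕ` all of whose entries are `0` or `1`.
-/

namespace SQ

variable {n : ℕ}

/-- All entries are `0` or `1`. -/
def IsZeroOne (M : Matrix (Fin n) (Fin n) ℕ) : Prop :=
  ∀ i j, M i j = 0 ∨ M i j = 1

/-- Row-strong quadrangularity: if in a set `S` of rows every row is non-orthogonal to some
other row of `S`, then at least `|S|` columns contain at least two ones in the rows of `S`. -/
def IsRowStronglyQuadrangular (M : Matrix (Fin n) (Fin n) ℕ) : Prop :=
  ∀ S : Finset (Fin n),
    (∀ u ∈ S, ∃ v ∈ S, v ≠ u ∧ M u ⬝ᵥ M v ≠ 0) →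
      S.card ≤ (Finset.univ.filter fun j => 2 ≤ (S.filter fun i => M i j = 1).card).card

/-- No row and no column consists of zeros only. -/
def HasNoZeroLine (M : Matrix (Fin n) (Fin n) ℕ) : Prop :=
  (∀ i, ∃ j, M i j ≠ 0) ∧ (∀ j, ∃ i, M i j ≠ 0)

/-- A (0,1)-matrix is strongly quadrangular if it and its transpose are row-strongly
quadrangular. -/
def IsStronglyQuadrangular (M : Matrix (Fin n) (Fin n) ℕ) : Prop :=
  IsZeroOne M ∧ IsRowStronglyQuadrangular M ∧ IsRowStronglyQuadrangular M.transpose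

/-- The matrices that are classified: strongly quadrangular and without zero lines. -/
def IsSQ (M : Matrix (Fin n) (Fin n) ℕ) : Prop :=
  IsStronglyQuadrangular M ∧ HasNoZeroLine M

/-- There is no `r × (n - r)` zero submatrix with `1 ≤ r ≤ n - 1`. -/
def IsIndecomposable (M : Matrix (Fin n) (Fin n) ℕ) : Prop :=
  ¬ ∃ R C : Finset (Fin n), R.Nonempty ∧ C.Nonempty ∧ R.card + C.card = n ∧
    ∀ i ∈ R, ∀ j ∈ C, M i j = 0

/-- All row sums and all column sums are equal to `k`. -/
def IsRegularOf (k : ℕ) (M : Matrix (Fin n) (Fin n) ℕ) : Prop :=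
  (∀ i, ∑ j, M i j = k) ∧ (∀ j, ∑ i, M i j = k)

/-- All row sums and column sums are equal to one common number. -/
def IsRegular (M : Matrix (Fin n) (Fin n) ℕ) : Prop :=
  ∃ k, IsRegularOf k M

/-- `P * M * Q = N` for some permutation matrices `P` and `Q`. -/
def Equivalent (M N : Matrix (Fin n) (Fin n) ℕ) : Prop :=
  ∃ σ τ : Equiv.Perm (Fin n), σ.permMatrix ℕ * M * τ.permMatrix ℕ = N

/-- The number of pairs `(P, Q)` of permutation matrices with `P * M * Q = M`. -/
noncomputable def autOrder (M : Matrix (Fin n) (Fin n) ℕ) : ℕ :=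
  Nat.card {p : Equiv.Perm (Fin n) × Equiv.Perm (Fin n) //
    p.1.permMatrix ℕ * M * p.2.permMatrix ℕ = M}

/-- Some unitary matrix has its nonzero entries exactly at the ones of `M`. -/
def SupportsUnitary (M : Matrix (Fin n) (Fin n) ℕ) : Prop :=
  ∃ U ∈ Matrix.unitaryGroup (Fin n) ℂ, ∀ i j, U i j ≠ 0 ↔ M i j = 1

theorem equivalent_refl (M : Matrix (Fin n) (Fin n) ℕ) : Equivalent M M :=
  ⟨1, 1, by simp⟩

theorem equivalent_symm {M N : Matrix (Fin n) (Fin n) ℕ} (h : Equivalent M N) :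
    Equivalent N M := by
  obtain ⟨σ, τ, rfl⟩ := h
  refine ⟨σ⁻¹, τ⁻¹, ?_⟩
  rw [← Matrix.mul_assoc, ← Matrix.mul_assoc, ← Matrix.permMatrix_mul, Matrix.mul_assoc _ _ _,
    ← Matrix.permMatrix_mul]
  simp

theorem equivalent_trans {M N K : Matrix (Fin n) (Fin n) ℕ} (h : Equivalent M N)
    (h' : Equivalent N K) : Equivalent M K := by
  obtain ⟨σ, τ, rfl⟩ := h
  obtain ⟨σ', τ', rfl⟩ := h'
  refine ⟨σ * σ', τ' * τ, ?_⟩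
  rw [Matrix.permMatrix_mul, Matrix.permMatrix_mul]
  simp only [Matrix.mul_assoc]

/-- Permutation equivalence as an equivalence relation on square matrices of degree `n`. -/
def equivSetoid (n : ℕ) : Setoid (Matrix (Fin n) (Fin n) ℕ) where
  r := Equivalent
  iseqv := ⟨equivalent_refl, equivalent_symm, equivalent_trans⟩

/-- The number of equivalence classes that contain a matrix with the property `p`, that is, the
number of inequivalent matrices with this property. -/
noncomputable def numClasses (p : Matrix (Fin n) (Fin n) ℕ → Prop) : ℕ :=
  Set.ncard {c : Quotient (equivSetoid n) | ∃ M, p M ∧ Quotient.mk (equivSetoid n) M = c}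

/-- `L` lists the matrices with the property `p` up to equivalence, each class once. -/
def IsCompleteList (p : Matrix (Fin n) (Fin n) ℕ → Prop)
    (L : List (Matrix (Fin n) (Fin n) ℕ)) : Prop :=
  (∀ A ∈ L, p A) ∧ L.Pairwise (fun A B => ¬ Equivalent A B) ∧
    ∀ M, p M → ∃ A ∈ L, Equivalent M A

/-- The number of triples of standard Young tableaux with `m` cells that have the same shape,
where the shape has at most three rows. The order on the cells is the product order. -/
noncomputable def numTableauTriples (m : ℕ) : ℕ :=
  Nat.card (Σ μ : {μ : YoungDiagram // μ.card = m ∧ μ.colLen 0 ≤ 3},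
    (Fin 3 → {T : μ.1.cells ≃ Fin m // StrictMono T}))

/-- A matrix with the order of its automorphism group and four indices. -/
structure Entry (n : ℕ) where
  mat : Matrix (Fin n) (Fin n) ℕ
  aut : ℕ
  idxR : Bool
  idxS : Bool
  idxT : Bool
  idxN : Bool

namespace Entry

def S (M : Matrix (Fin n) (Fin n) ℕ) (a : ℕ) : Entry n := ⟨M, a, false, true, false, false⟩

def RS (M : Matrix (Fin n) (Fin n) ℕ) (a : ℕ) : Entry n := ⟨M, a, true, true, false, false⟩

def T (M : Matrix (Fin n) (Fin n) ℕ) (a : ℕ) : Entry n := ⟨M, a, false, false, true, false⟩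

def NS (M : Matrix (Fin n) (Fin n) ℕ) (a : ℕ) : Entry n := ⟨M, a, false, true, false, true⟩

def NRS (M : Matrix (Fin n) (Fin n) ℕ) (a : ℕ) : Entry n := ⟨M, a, true, true, false, true⟩

/-- The printed data of an entry are right: the order of the automorphism group; `R` marks exactly
the regular matrices, `S` exactly those equivalent to a symmetric matrix, `T` exactly those not
equivalent to their transpose; and the matrices marked `N` do not support unitaries. -/
def Correct (e : Entry n) : Prop :=
  autOrder e.mat = e.aut ∧
  (e.idxR = true ↔ IsRegular e.mat) ∧
  (e.idxS = true ↔ ∃ A : Matrix (Fin n) (Fin n) ℕ, A.IsSymm ∧ Equivalent e.mat A) ∧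
  (e.idxT = true ↔ ¬ Equivalent e.mat e.mat.transpose) ∧
  (e.idxN = true → ¬ SupportsUnitary e.mat)

end Entry

/-- The matrices of a list of entries, where an entry with index `T` also stands for its
transpose. -/
def expand (L : List (Entry n)) : List (Matrix (Fin n) (Fin n) ℕ) :=
  L.flatMap fun e => if e.idxT then [e.mat, e.mat.transpose] else [e.mat]

/-- The all-ones matrix of degree `n`. -/
def allOnes (n : ℕ) : Matrix (Fin n) (Fin n) ℕ := Matrix.of fun _ _ => 1

/-- The matrix of degree 6 that is the direct sum of all-ones matrices of degree `d`
(for `d` a positive divisor of 6). -/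
def blockOnes (d : ℕ) : Matrix (Fin 6) (Fin 6) ℕ :=
  Matrix.of fun i j => if i.val / d = j.val / d then 1 else 0

/-- The indecomposable SQ matrices of degree 1. -/
def list1 : List (Entry 1) :=
  [.RS !![1] 1]

/-- The indecomposable SQ matrices of degree 2. -/
def list2 : List (Entry 2) :=
  [.RS !![1, 1; 1, 1] 4]

/-- The indecomposable SQ matrices of degree 3. -/
def list3 : List (Entry 3) :=
  [.S !![0, 1, 1; 1, 1, 1; 1, 1, 1] 4,
   .RS !![1, 1, 1; 1, 1, 1; 1, 1, 1] 36]

/-- The indecomposable SQ matrices of degree 4. -/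
def list4 : List (Entry 4) :=
  [.S !![0, 1, 1, 1; 1, 1, 1, 1; 1, 1, 1, 1; 1, 1, 1, 1] 36,
   .S !![0, 1, 1, 1; 1, 0, 1, 1; 1, 1, 1, 1; 1, 1, 1, 1] 8,
   .S !![0, 1, 1, 1; 1, 0, 1, 1; 1, 1, 0, 1; 1, 1, 1, 1] 6,
   .RS !![0, 1, 1, 1; 1, 0, 1, 1; 1, 1, 0, 1; 1, 1, 1, 0] 24,
   .S !![0, 0, 1, 1; 0, 1, 1, 1; 1, 1, 1, 1; 1, 1, 1, 1] 4,
   .T !![0, 0, 1, 1; 1, 1, 1, 1; 1, 1, 1, 1; 1, 1, 1, 1] 24,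
   .T !![1, 0, 1, 1; 0, 1, 1, 1; 1, 0, 1, 1; 0, 1, 1, 1] 16,
   .RS !![1, 1, 1, 1; 1, 1, 1, 1; 1, 1, 1, 1; 1, 1, 1, 1] 576]

/-- The indecomposable SQ matrices of degree 5. -/
def list5 : List (Entry 5) :=
  [.S !![0, 1, 1, 1, 1; 1, 1, 1, 1, 1; 1, 1, 1, 1, 1; 1, 1, 1, 1, 1; 1, 1, 1, 1, 1] 576,
   .S !![0, 1, 1, 1, 1; 1, 0, 1, 1, 1; 1, 1, 1, 1, 1; 1, 1, 1, 1, 1; 1, 1, 1, 1, 1] 72,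
   .S !![0, 1, 1, 1, 1; 1, 0, 1, 1, 1; 1, 1, 0, 1, 1; 1, 1, 1, 1, 1; 1, 1, 1, 1, 1] 24,
   .S !![0, 1, 1, 1, 1; 1, 0, 1, 1, 1; 1, 1, 0, 1, 1; 1, 1, 1, 0, 1; 1, 1, 1, 1, 1] 24,
   .RS !![0, 1, 1, 1, 1; 1, 0, 1, 1, 1; 1, 1, 0, 1, 1; 1, 1, 1, 0, 1; 1, 1, 1, 1, 0] 120,
   .S !![0, 0, 0, 1, 1; 0, 0, 1, 1, 1; 0, 1, 1, 1, 1; 1, 1, 1, 1, 1; 1, 1, 1, 1, 1] 4,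
   .S !![0, 0, 0, 1, 1; 0, 1, 1, 1, 1; 0, 1, 1, 1, 1; 1, 1, 1, 1, 1; 1, 1, 1, 1, 1] 16,
   .S !![0, 0, 0, 1, 1; 0, 1, 1, 1, 1; 0, 1, 1, 1, 1; 1, 1, 1, 0, 0; 1, 1, 1, 0, 0] 16,
   .S !![0, 0, 1, 1, 1; 0, 1, 1, 1, 1; 1, 1, 1, 1, 1; 1, 1, 1, 1, 1; 1, 1, 1, 1, 1] 36,
   .S !![0, 0, 1, 1, 1; 0, 1, 1, 1, 1; 1, 1, 0, 1, 1; 1, 1, 1, 1, 1; 1, 1, 1, 1, 1] 4,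
   .S !![0, 0, 1, 1, 1; 0, 1, 1, 1, 1; 1, 1, 0, 1, 1; 1, 1, 1, 0, 1; 1, 1, 1, 1, 1] 2,
   .S !![0, 0, 1, 1, 1; 0, 1, 1, 1, 1; 1, 1, 0, 1, 1; 1, 1, 1, 0, 1; 1, 1, 1, 1, 0] 6,
   .S !![0, 0, 1, 1, 1; 0, 0, 1, 1, 1; 1, 1, 1, 1, 1; 1, 1, 1, 1, 1; 1, 1, 1, 1, 1] 144,
   .S !![0, 0, 1, 1, 1; 0, 0, 1, 1, 1; 1, 1, 0, 1, 1; 1, 1, 1, 1, 1; 1, 1, 1, 1, 1] 16,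
   .NS !![0, 0, 1, 1, 1; 0, 0, 1, 1, 1; 1, 1, 0, 1, 1; 1, 1, 1, 0, 1; 1, 1, 1, 1, 1] 8,
   .NS !![0, 0, 1, 1, 1; 0, 0, 1, 1, 1; 1, 1, 0, 1, 1; 1, 1, 1, 0, 1; 1, 1, 1, 1, 0] 24,
   .S !![0, 0, 1, 1, 1; 0, 1, 0, 1, 1; 1, 0, 1, 1, 1; 1, 1, 1, 1, 1; 1, 1, 1, 1, 1] 4,
   .S !![0, 0, 1, 1, 1; 0, 1, 0, 1, 1; 1, 0, 1, 1, 1; 1, 1, 1, 0, 1; 1, 1, 1, 1, 1] 1,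
   .S !![0, 0, 1, 1, 1; 0, 1, 0, 1, 1; 1, 0, 1, 1, 1; 1, 1, 1, 0, 1; 1, 1, 1, 1, 0] 2,
   .S !![1, 0, 0, 1, 1; 0, 1, 1, 1, 1; 0, 1, 1, 1, 1; 1, 1, 1, 1, 1; 1, 1, 1, 1, 1] 16,
   .S !![1, 0, 0, 1, 1; 0, 1, 1, 1, 1; 0, 1, 1, 1, 1; 1, 1, 1, 0, 1; 1, 1, 1, 1, 1] 4,
   .S !![1, 0, 0, 1, 1; 0, 1, 1, 1, 1; 0, 1, 1, 1, 1; 1, 1, 1, 0, 1; 1, 1, 1, 1, 0] 8,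
   .RS !![1, 1, 1, 1, 1; 1, 1, 1, 1, 1; 1, 1, 1, 1, 1; 1, 1, 1, 1, 1; 1, 1, 1, 1, 1] 14400,
   .T !![0, 0, 1, 1, 1; 1, 1, 1, 1, 1; 1, 1, 1, 1, 1; 1, 1, 1, 1, 1; 1, 1, 1, 1, 1] 288,
   .T !![0, 0, 0, 1, 1; 1, 1, 1, 1, 1; 1, 1, 1, 1, 1; 1, 1, 1, 1, 1; 1, 1, 1, 1, 1] 288,
   .T !![0, 0, 0, 1, 1; 0, 1, 1, 1, 1; 1, 1, 1, 1, 1; 1, 1, 1, 1, 1; 1, 1, 1, 1, 1] 24,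
   .T !![0, 0, 0, 1, 1; 0, 1, 1, 1, 1; 1, 0, 1, 1, 1; 1, 1, 1, 1, 1; 1, 1, 1, 1, 1] 8,
   .T !![0, 0, 0, 1, 1; 0, 1, 1, 1, 1; 1, 0, 1, 1, 1; 1, 1, 0, 1, 1; 1, 1, 1, 1, 1] 12,
   .T !![0, 0, 0, 1, 1; 1, 1, 1, 1, 1; 1, 1, 1, 1, 1; 1, 1, 1, 1, 1; 1, 1, 1, 0, 0] 72,
   .T !![0, 0, 0, 1, 1; 0, 1, 1, 1, 1; 1, 1, 1, 1, 1; 1, 1, 1, 1, 1; 1, 1, 1, 0, 0] 8,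
   .T !![0, 0, 0, 1, 1; 0, 1, 1, 1, 1; 1, 0, 1, 1, 1; 1, 1, 1, 1, 1; 1, 1, 1, 0, 0] 4,
   .T !![0, 0, 0, 1, 1; 0, 1, 1, 1, 1; 1, 0, 1, 1, 1; 1, 1, 0, 1, 1; 1, 1, 1, 0, 0] 12,
   .T !![0, 0, 1, 1, 1; 0, 1, 0, 1, 1; 1, 1, 1, 1, 1; 1, 1, 1, 1, 1; 1, 1, 1, 1, 1] 24,
   .T !![0, 0, 1, 1, 1; 0, 1, 0, 1, 1; 1, 1, 1, 0, 1; 1, 1, 1, 1, 1; 1, 1, 1, 1, 1] 4,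
   .T !![0, 0, 1, 1, 1; 0, 1, 0, 1, 1; 1, 1, 1, 0, 1; 1, 1, 1, 1, 0; 1, 1, 1, 1, 1] 4,
   .T !![0, 0, 0, 1, 1; 0, 1, 1, 0, 0; 1, 1, 1, 1, 1; 1, 1, 1, 1, 1; 1, 1, 1, 1, 1] 48,
   .T !![0, 0, 1, 1, 1; 1, 1, 0, 1, 1; 1, 1, 1, 1, 1; 1, 1, 1, 1, 1; 1, 1, 1, 1, 1] 24,
   .T !![0, 0, 1, 1, 1; 1, 1, 0, 1, 1; 1, 1, 1, 0, 1; 1, 1, 1, 1, 1; 1, 1, 1, 1, 1] 8,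
   .T !![0, 0, 1, 1, 1; 1, 1, 0, 1, 1; 1, 1, 1, 0, 1; 1, 1, 1, 1, 0; 1, 1, 1, 1, 1] 12,
   .T !![0, 0, 0, 1, 1; 1, 1, 1, 0, 0; 1, 1, 1, 0, 0; 1, 1, 1, 1, 1; 1, 1, 1, 1, 1] 48,
   .T !![0, 0, 0, 1, 1; 0, 0, 1, 1, 1; 1, 1, 1, 1, 1; 1, 1, 1, 1, 1; 1, 1, 1, 1, 1] 24,
   .T !![0, 0, 0, 1, 1; 0, 0, 1, 1, 1; 1, 1, 0, 0, 0; 1, 1, 1, 1, 1; 1, 1, 1, 1, 1] 8,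
   .T !![0, 0, 0, 1, 1; 0, 1, 1, 0, 0; 0, 1, 1, 1, 1; 1, 1, 1, 1, 1; 1, 1, 1, 1, 1] 16]

/-- The regular SQ matrices of degree 6 with four ones in every row. -/
def list6 : List (Entry 6) :=
  [.RS !![1, 0, 0, 1, 1, 1; 0, 1, 0, 1, 1, 1; 0, 0, 1, 1, 1, 1; 1, 1, 1, 1, 0, 0; 1, 1, 1, 0, 1, 0; 1, 1, 1, 0, 0, 1] 72,
   .RS !![0, 0, 1, 1, 1, 1; 0, 0, 1, 1, 1, 1; 1, 1, 0, 0, 1, 1; 1, 1, 0, 0, 1, 1; 1, 1, 1, 1, 0, 0; 1, 1, 1, 1, 0, 0] 384,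
   .RS !![1, 1, 1, 1, 0, 0; 0, 1, 1, 1, 1, 0; 0, 0, 1, 1, 1, 1; 1, 0, 0, 1, 1, 1; 1, 1, 0, 0, 1, 1; 1, 1, 1, 0, 0, 1] 12,
   .NRS !![0, 0, 1, 1, 1, 1; 0, 0, 1, 1, 1, 1; 1, 1, 1, 1, 0, 0; 1, 1, 0, 1, 1, 0; 1, 1, 0, 0, 1, 1; 1, 1, 1, 0, 0, 1] 32]

end SQ

/-! The theorem is a finite computation. It is made small by arithmetic encodings and tied to the
definitions by correctness lemmas for Boolean tests, which are then evaluated on the printed lists.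

A row becomes a number with base-64 digits 0 and 1. As 64 ≡ 1 modulo 63, the residue modulo 63
counts its ones, and bitwise operations treat all columns at once. With at most six rows, a column
read in binary fits into one digit. The multiset of columns becomes the number `colKey`, the sum of
8 to the column codes; equal keys mean equality up to a column permutation (`colKey_eq_iff`). Hence
equivalence, symmetrizability and automorphisms need enumerations of row or of column permutations,
never of pairs.

Inequivalence follows from distinct values of an invariant (`classInvariant_eq_of_equivalent`). For
completeness, each class has a representative with increasing row sums and increasing column codes
(`exists_sorted`). A depth-first search builds it from the last row upwards, pruned by the sorting
and by the fact that two rows of an SQ matrix never share exactly one column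
(`mayExtend_of_sorted`). Every SQ leaf must agree, after a row permutation, with the key of a listed
matrix (`exists_equivalent_of_searchSQ`). Up to degree 5 the search covers all SQ matrices, so the
decomposable ones are listed too; in degree 6 it fixes the row sum and also bounds the column sums.

The class numbers are read off the complete lists. The tableau numbers are sums over shapes of cubes
of numbers of standard tableaux. Matrices marked N have two rows that orthogonality to the other
rows would force to be proportional in any unitary (`HasLinkedRows.not_supportsUnitary`). -/

namespace SQ

variable {n : ℕ}

/-! ### Decision procedures on row codes -/

/-- The number with base-64 digits `a 0, a 1, …`. -/
def pack (a : Fin n → ℕ) : ℕ := ∑ j, a j * 64 ^ j.val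

/-- The rows of a matrix as numbers, with the entries of the row as base-64 digits. -/
def rowCodes (M : Matrix (Fin n) (Fin n) ℕ) : List ℕ := List.ofFn fun i => pack (M i)

/-- The `j`-th base-64 digit. -/
def digit (a j : ℕ) : ℕ := Nat.mod (Nat.div a (Nat.pow 64 j)) 64

/-- The code of the `j`-th column of the matrix with row codes `l`. -/
def colCode (l : List ℕ) (j : ℕ) : ℕ := l.foldr (fun r c => Nat.add (digit r j) (Nat.mul c 64)) 0

/-- The row codes of the transpose. -/
def colCodes (n : ℕ) (l : List ℕ) : List ℕ := (List.range n).map (colCode l)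

/-- The columns, read as binary numbers, as base-64 digits. -/
def colPack (l : List ℕ) : ℕ := l.foldr (fun r c => Nat.add r (Nat.mul c 2)) 0

/-- The multiset of the columns of the matrix with row codes `l`, encoded as a number. -/
def colKey (n : ℕ) (l : List ℕ) : ℕ :=
  (List.range n).foldr (fun j c => Nat.add (Nat.pow 8 (digit (colPack l) j)) c) 0

/-- A number that depends only on the equivalence class of the matrix with row codes `l`. -/
def classInvariant (n : ℕ) (l : List ℕ) : ℕ :=
  (l.permutations'.map fun p => Nat.pow (colKey n p) 3).foldr Nat.add 0

/-- Bitwise disjunction of the members of a list. -/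
def once : List ℕ → ℕ
  | [] => 0
  | r :: l => Nat.lor r (once l)

/-- The bits that are set in at least two members of a list. -/
def twice : List ℕ → ℕ
  | [] => 0
  | r :: l => Nat.lor (twice l) (Nat.land r (once l))

/-- `P` holds for all lists that arise from `S` by adding members of a sublist. -/
def allSub (P : List ℕ → Bool) : List ℕ → List ℕ → Bool
  | [], S => P S
  | r :: l, S => allSub P l S && allSub P l (r :: S)

/-- The quadrangularity condition for one set of rows. -/
def quadSet (S : List ℕ) : Bool :=
  S.any (fun r => Nat.beq (Nat.land r (twice S)) 0) || Nat.ble S.length (Nat.mod (twice S) 63)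

/-- Decision procedure for `IsRowStronglyQuadrangular`. -/
def rowSQB (l : List ℕ) : Bool := allSub quadSet l []

/-- Decision procedure for `IsSQ`. -/
def sqB (n : ℕ) (l : List ℕ) : Bool :=
  l.all (· != 0) && (colCodes n l).all (· != 0) && rowSQB (colCodes n l) && rowSQB l

/-- Decision procedure for `IsIndecomposable`. -/
def indecB (n : ℕ) (l : List ℕ) : Bool :=
  allSub (fun S => S.length == 0 || Nat.ble n S.length || Nat.blt S.length (once S % 63)) l []

/-- Some row permutation makes the matrix symmetric. -/
def symB (n : ℕ) (l : List ℕ) : Bool := l.permutations'.any fun p => colCodes n p == p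

/-- The order of the automorphism group. -/
def autB (n : ℕ) (l : List ℕ) : ℕ :=
  l.permutations'.countP (fun p => Nat.beq (colKey n p) (colKey n l)) *
    (colCodes n l).permutations'.countP (· == colCodes n l)

/-- The adjacent positions in which all members of the list have equal digits. -/
def eqMask (n : ℕ) : List ℕ → ℕ
  | [] => pack fun _ : Fin (n - 1) => 1
  | r :: s => eqMask n s &&& ((pack fun _ : Fin n => 1) ^^^ (r ^^^ (r >>> 6)))

/-- Necessary conditions for adding the row `r` on top of the rows `s` of a matrix with sorted row
sums and sorted columns in which no two rows have exactly one common column. -/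
def mayExtend (n : ℕ) (s : List ℕ) (r : ℕ) : Bool :=
  (r &&& eqMask n s) &&& (r >>> 6) == r &&& eqMask n s &&
    s.all fun x => Nat.ble (r % 63) (x % 63) && (r &&& x) % 63 != 1

/-- The codes of all rows of length `n`. -/
def allCodes : ℕ → List ℕ
  | 0 => [0]
  | n + 1 => (allCodes n).flatMap fun c => [c * 64, c * 64 + 1]

/-- Depth-first search: `leaf` holds for all lists obtained from `l` by adding `k` members of
`cand`, each admissible on top of the preceding ones. -/
def search (cand : List ℕ) (ok : List ℕ → ℕ → Bool) (leaf : List ℕ → Bool) :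
    ℕ → List ℕ → Bool
  | 0, l => leaf l
  | k + 1, l => cand.all fun r => !ok l r || search cand ok leaf k (r :: l)

/-- All SQ matrices whose rows have codes in `cand` and whose lower parts satisfy `extra` are
equivalent to a matrix with column key in `keys`. -/
def searchSQ (n : ℕ) (cand : List ℕ) (extra : List ℕ → ℕ → Bool) (keys : List ℕ) : Bool :=
  search cand (fun s r => mayExtend n s r && extra s r)
    (fun l => !sqB n l || l.permutations'.any fun p => keys.elem (colKey n p)) n []

/-- The column sums of the rows `r :: s` can be completed to `w`. -/
def colSums (n w : ℕ) (s : List ℕ) (r : ℕ) : Bool :=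
  (List.range n).all fun j =>
    Nat.ble (digit (r :: s).sum j) w &&
      Nat.ble w (digit (r :: s).sum j + (n - (s.length + 1)))

/-! ### Digits -/

/-- The base stays general because three kinds of digits are read: matrix entries (64), bits of a
column code (2), and multiplicities of columns (8). -/
theorem sum_mul_pow_div_mod (b : ℕ) (a : Fin n → ℕ) (h : ∀ j, a j < b) (j : Fin n) :
    (∑ j, a j * b ^ j.val) / b ^ j.val % b = a j := by
  induction n with
  | zero => exact j.elim0
  | succ n ih =>
    have hb : 0 < b := (Nat.zero_le _).trans_lt (h 0)
    have e : ∑ j, a j * b ^ j.val = a 0 + b * ∑ j : Fin n, a j.succ * b ^ j.val := by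
      rw [Fin.sum_univ_succ, Finset.mul_sum]
      simp only [Fin.val_zero, pow_zero, mul_one, Fin.val_succ, pow_succ]
      congr 1
      exact Finset.sum_congr rfl fun _ _ => by ring
    rw [e]
    refine Fin.cases ?_ (fun i => ?_) j
    · simp [Nat.mod_eq_of_lt (h 0)]
    · rw [Fin.val_succ, pow_succ', ← Nat.div_div_eq_div_mul, Nat.add_mul_div_left _ _ hb,
        Nat.div_eq_of_lt (h 0), zero_add]
      exact ih (fun j => a j.succ) (fun j => h _) i

theorem digit_pack {a : Fin n → ℕ} (h : ∀ j, a j < 64) (j : Fin n) :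
    digit (pack a) j = a j :=
  sum_mul_pow_div_mod 64 a h j

theorem pack_injective {a b : Fin n → ℕ} (ha : ∀ j, a j < 64) (hb : ∀ j, b j < 64)
    (h : pack a = pack b) : a = b := by
  funext j
  rw [← digit_pack ha, ← digit_pack hb, h]

theorem foldr_ofFn_horner (b : ℕ) (f : Fin n → ℕ) :
    (List.ofFn f).foldr (fun r c => r + c * b) 0 = ∑ i, f i * b ^ i.val := by
  induction n with
  | zero => simp
  | succ n ih =>
    rw [List.ofFn_succ, List.foldr_cons, ih, Fin.sum_univ_succ, Finset.sum_mul]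
    simp only [Fin.val_zero, pow_zero, mul_one, Fin.val_succ, pow_succ]
    congr 1
    exact Finset.sum_congr rfl fun _ _ => by ring

theorem sum_pack {ι : Type*} (s : Finset ι) (f : ι → Fin n → ℕ) :
    ∑ i ∈ s, pack (f i) = pack fun j => ∑ i ∈ s, f i j := by
  simp only [pack, Finset.sum_mul]
  exact Finset.sum_comm

theorem pack_mul (a : Fin n → ℕ) (c : ℕ) : pack a * c = pack fun j => a j * c := by
  simp only [pack, Finset.sum_mul]
  exact Finset.sum_congr rfl fun _ _ => by ring

/-- Doubling and adding act on all digits at once, so one Horner pass over the rows yields the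
binary codes of all columns. -/
theorem colPack_ofFn {m : ℕ} (f : Fin m → Fin n → ℕ) :
    colPack (List.ofFn fun i => pack (f i)) = pack fun j => ∑ i, f i j * 2 ^ i.val := by
  have h := foldr_ofFn_horner 2 fun i => pack (f i)
  simp only [pack_mul, sum_pack] at h
  exact h

theorem sum_two_pow_lt {m k : ℕ} (hm : m ≤ k) (a : Fin m → ℕ) (h : ∀ i, a i ≤ 1) :
    ∑ i, a i * 2 ^ i.val < 2 ^ k := by
  calc ∑ i, a i * 2 ^ i.val ≤ ∑ i : Fin m, 2 ^ i.val :=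
        Finset.sum_le_sum fun i _ => (Nat.mul_le_mul_right _ (h i)).trans (one_mul _).le
    _ = ∑ i ∈ Finset.range m, 2 ^ i := Fin.sum_univ_eq_sum_range (fun i => 2 ^ i) m
    _ < 2 ^ m := Nat.geomSum_lt le_rfl fun k hk => Finset.mem_range.1 hk
    _ ≤ 2 ^ k := Nat.pow_le_pow_right (by norm_num) hm

theorem colKey_ofFn {m : ℕ} (hm : m ≤ 6) (f : Fin m → Fin n → ℕ) (hf : ∀ i j, f i j ≤ 1) :
    colKey n (List.ofFn fun i => pack (f i)) = ∑ j, 8 ^ (∑ i, f i j * 2 ^ i.val) := by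
  have h : ∀ l : List ℕ, ∀ g : ℕ → ℕ,
      l.foldr (fun j c => Nat.add (Nat.pow 8 (g j)) c) 0 = (l.map fun j => 8 ^ g j).sum := by
    intro l g
    induction l with
    | nil => rfl
    | cons a l ih => rw [List.foldr_cons, ih, List.map_cons, List.sum_cons]; rfl
  rw [colKey, h, ← List.sum_toFinset _ List.nodup_range, List.toFinset_range,
    ← Fin.sum_univ_eq_sum_range (fun j => 8 ^ digit (colPack _) j)]
  refine Finset.sum_congr rfl fun j _ => ?_
  rw [colPack_ofFn, digit_pack fun j => sum_two_pow_lt hm _ fun i => hf i j]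

theorem colCode_ofFn {m : ℕ} (f : Fin m → Fin n → ℕ) (hf : ∀ i j, f i j < 64) (j : Fin n) :
    colCode (List.ofFn fun i => pack (f i)) j = pack fun i => f i j := by
  have h : ∀ l : List ℕ, colCode l j = (l.map (digit · j)).foldr (fun r c => r + c * 64) 0 := by
    intro l
    rw [List.foldr_map]
    rfl
  rw [h, List.map_ofFn, foldr_ofFn_horner]
  exact Finset.sum_congr rfl fun i _ => by rw [Function.comp_apply, digit_pack (hf i)]

theorem colCodes_rowCodes {M : Matrix (Fin n) (Fin n) ℕ} (h : ∀ i j, M i j < 64) :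
    colCodes n (rowCodes M) = rowCodes M.transpose := by
  refine List.ext_getElem (by simp [colCodes, rowCodes]) fun j h₁ h₂ => ?_
  have hj : j < n := by simpa [colCodes] using h₁
  simp only [colCodes, List.getElem_map, List.getElem_range]
  rw [rowCodes, colCode_ofFn M h ⟨j, hj⟩]
  simp [rowCodes]
  rfl

theorem rowCodes_injective {M N : Matrix (Fin n) (Fin n) ℕ} (hM : ∀ i j, M i j < 64)
    (hN : ∀ i j, N i j < 64) (h : rowCodes M = rowCodes N) : M = N := by
  funext i
  exact pack_injective (hM i) (hN i) (congrFun (List.ofFn_injective h) i)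

/-! ### Permutations as lists -/

/-- The equality is one of multisets: rows may coincide, and counting must count permutations rather
than distinct lists. It is proved for the list of indices, where both sides are free of duplicates,
and then mapped along `f`. -/
theorem coe_permutations'_ofFn {α : Type*} (f : Fin n → α) :
    ((List.ofFn f).permutations' : Multiset (List α)) =
      Finset.univ.val.map fun σ : Equiv.Perm (Fin n) => List.ofFn (f ∘ σ) := by
  have h : (((List.finRange n).permutations' : List _) : Multiset (List (Fin n))) =
      Finset.univ.val.map fun σ : Equiv.Perm (Fin n) => List.ofFn σ := by
    refine (Multiset.Nodup.ext ?_ ?_).2 fun l => ?_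
    · exact Multiset.coe_nodup.2 ((List.permutations_perm_permutations' _).nodup_iff.1
        (List.nodup_permutations _ (List.nodup_finRange n)))
    · exact Finset.univ.nodup.map fun σ τ h => Equiv.ext (congrFun (List.ofFn_injective h))
    · simp only [Multiset.mem_coe, List.mem_permutations', Multiset.mem_map, Finset.mem_val,
        Finset.mem_univ, true_and]
      constructor
      · intro hl
        have hn : l.length = n := by simpa using hl.length_eq
        have hd : l.Nodup := hl.nodup_iff.2 (List.nodup_finRange n)
        have hi : Function.Injective fun i : Fin n => l.get (i.cast hn.symm) := fun i j h => by
          simpa using hd.injective_get h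
        refine ⟨Equiv.ofBijective _ (Finite.injective_iff_bijective.1 hi), ?_⟩
        refine List.ext_getElem (by simp [hn]) fun i h₁ h₂ => by simp
      · rintro ⟨σ, rfl⟩
        have := σ.ofFn_comp_perm id
        simpa [List.ofFn_id] using this
  have e := congrArg (Multiset.map (List.map f)) h
  rw [Multiset.map_coe, List.map_permutations', Multiset.map_map, ← List.ofFn_eq_map] at e
  rw [e]
  exact Multiset.map_congr rfl fun σ _ => by simp [List.map_ofFn]

theorem mem_permutations'_ofFn {α : Type*} {f : Fin n → α} {l : List α} :
    l ∈ (List.ofFn f).permutations' ↔ ∃ σ : Equiv.Perm (Fin n), List.ofFn (f ∘ σ) = l := by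
  rw [← Multiset.mem_coe, coe_permutations'_ofFn]
  simp

theorem countP_permutations'_ofFn {α : Type*} (f : Fin n → α) (P : List α → Bool) :
    (List.ofFn f).permutations'.countP P =
      Nat.card {σ : Equiv.Perm (Fin n) // P (List.ofFn (f ∘ σ)) = true} := by
  have h := Multiset.coe_countP (fun l => P l = true) (List.ofFn f).permutations'
  simp only [Bool.decide_eq_true] at h
  rw [← h, coe_permutations'_ofFn, Multiset.countP_map, Nat.card_eq_fintype_card,
    Fintype.card_subtype]
  rfl

/-! ### Equivalence and column keys -/

theorem permMatrix_mul_mul (σ τ : Equiv.Perm (Fin n)) (M : Matrix (Fin n) (Fin n) ℕ) :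
    σ.permMatrix ℕ * M * τ.permMatrix ℕ = M.submatrix σ τ.symm := by
  rw [Equiv.Perm.permMatrix, Equiv.Perm.permMatrix, PEquiv.toMatrix_toPEquiv_mul,
    PEquiv.mul_toMatrix_toPEquiv, Matrix.submatrix_submatrix]
  rfl

theorem equivalent_iff {M N : Matrix (Fin n) (Fin n) ℕ} :
    Equivalent M N ↔ ∃ σ τ : Equiv.Perm (Fin n), M.submatrix σ τ = N := by
  simp only [Equivalent, permMatrix_mul_mul]
  exact ⟨fun ⟨σ, τ, h⟩ => ⟨σ, τ.symm, h⟩, fun ⟨σ, τ, h⟩ => ⟨σ, τ.symm, h⟩⟩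

/-- The digit at place `c` is the size of the fibre over `c`, and no carry occurs because a fibre
has at most `n < b` elements. Equal sums thus give equal fibre sizes, and bijections between the
fibres glue to a permutation. -/
theorem exists_perm_comp_eq_of_sum_pow_eq {b : ℕ} (hn : n < b) {f g : Fin n → ℕ}
    (h : ∑ j, b ^ f j = ∑ j, b ^ g j) : ∃ τ : Equiv.Perm (Fin n), f ∘ τ = g := by
  obtain ⟨N, hf, hg⟩ : ∃ N, (∀ j, f j < N) ∧ ∀ j, g j < N :=
    ⟨∑ j, f j + ∑ j, g j + 1,
      fun j => by have := Finset.single_le_sum (f := f) (fun _ _ => Nat.zero_le _)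
                    (Finset.mem_univ j); omega,
      fun j => by have := Finset.single_le_sum (f := g) (fun _ _ => Nat.zero_le _)
                    (Finset.mem_univ j); omega⟩
  have key : ∀ f : Fin n → ℕ, (∀ j, f j < N) → ∑ j, b ^ f j =
      ∑ c : Fin N, (Finset.univ.filter fun j => f j = c).card * b ^ c.val := by
    intro f hf
    simp only [Finset.card_filter, Finset.sum_mul]
    rw [Finset.sum_comm]
    refine Finset.sum_congr rfl fun j _ => ?_
    rw [Finset.sum_eq_single ⟨f j, hf j⟩]
    · simp
    · intro c _ hc
      rw [if_neg fun h => hc (Fin.ext h.symm), zero_mul]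
    · simp
  have lt : ∀ f : Fin n → ℕ, ∀ c : Fin N, (Finset.univ.filter fun j => f j = c).card < b :=
    fun f c => ((Finset.card_le_univ _).trans_eq (Fintype.card_fin n)).trans_lt hn
  have card : ∀ c, Fintype.card {j // g j = c} = Fintype.card {j // f j = c} := by
    intro c
    rw [Fintype.card_subtype, Fintype.card_subtype]
    by_cases hc : c < N
    · have hf' := sum_mul_pow_div_mod b _ (lt f) ⟨c, hc⟩
      have hg' := sum_mul_pow_div_mod b _ (lt g) ⟨c, hc⟩
      rw [← key f hf, h] at hf'
      rw [← key g hg] at hg'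
      exact hg'.symm.trans hf'
    · rw [Finset.filter_false_of_mem fun j _ (e : g j = c) => hc (e ▸ hg j),
        Finset.filter_false_of_mem fun j _ (e : f j = c) => hc (e ▸ hf j)]
  exact ⟨Equiv.ofFiberEquiv fun c => Fintype.equivOfCardEq (card c),
    funext fun j => Equiv.ofFiberEquiv_map _ j⟩

theorem colKey_eq_iff (hn : n ≤ 6) {M N : Matrix (Fin n) (Fin n) ℕ} (hM : ∀ i j, M i j ≤ 1)
    (hN : ∀ i j, N i j ≤ 1) :
    colKey n (rowCodes M) = colKey n (rowCodes N) ↔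
      ∃ τ : Equiv.Perm (Fin n), M.submatrix id τ = N := by
  rw [rowCodes, rowCodes, colKey_ofFn hn M hM, colKey_ofFn hn N hN]
  constructor
  · intro h
    obtain ⟨τ, hτ⟩ := exists_perm_comp_eq_of_sum_pow_eq (by omega) h
    refine ⟨τ, ?_⟩
    funext i j
    have := congrFun hτ j
    have h₁ := sum_mul_pow_div_mod 2 (fun i => M i (τ j)) (fun i => Nat.lt_succ_of_le (hM _ _)) i
    have h₂ := sum_mul_pow_div_mod 2 (fun i => N i j) (fun i => Nat.lt_succ_of_le (hN _ _)) i
    simp only [Function.comp_apply] at this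
    rw [this] at h₁
    exact h₁.symm.trans h₂
  · rintro ⟨τ, rfl⟩
    exact (Equiv.sum_comp τ fun j => 8 ^ ∑ i, M i j * 2 ^ i.val).symm

theorem ofFn_pack_comp (M : Matrix (Fin n) (Fin n) ℕ) (σ : Equiv.Perm (Fin n)) :
    List.ofFn ((fun i => pack (M i)) ∘ σ) = rowCodes (M.submatrix σ id) := rfl

theorem equivalent_iff_colKey (hn : n ≤ 6) {M N : Matrix (Fin n) (Fin n) ℕ}
    (hM : ∀ i j, M i j ≤ 1) (hN : ∀ i j, N i j ≤ 1) :
    Equivalent M N ↔ ∃ l ∈ (rowCodes M).permutations', colKey n l = colKey n (rowCodes N) := by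
  rw [equivalent_iff]
  constructor
  · rintro ⟨σ, τ, h⟩
    refine ⟨_, mem_permutations'_ofFn.2 ⟨σ, rfl⟩, ?_⟩
    rw [ofFn_pack_comp]
    exact (colKey_eq_iff hn (fun i j => hM _ _) hN).2 ⟨τ, h⟩
  · rintro ⟨l, hl, h⟩
    obtain ⟨σ, rfl⟩ := mem_permutations'_ofFn.1 hl
    rw [ofFn_pack_comp] at h
    obtain ⟨τ, h⟩ := (colKey_eq_iff hn (fun i j => hM _ _) hN).1 h
    exact ⟨σ, τ, h⟩

theorem classInvariant_rowCodes (M : Matrix (Fin n) (Fin n) ℕ) :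
    classInvariant n (rowCodes M) =
      ∑ σ : Equiv.Perm (Fin n), colKey n (rowCodes (M.submatrix σ id)) ^ 3 := by
  have h : ∀ l : List ℕ, l.foldr Nat.add 0 = (l : Multiset ℕ).sum := fun l => by
    rw [Multiset.sum_coe]; rfl
  rw [classInvariant, h, ← Multiset.map_coe, rowCodes, coe_permutations'_ofFn, Multiset.map_map]
  rfl

/-- A row permutation only reindexes the sum, and a column permutation changes no key. The cube is
there because the plain sum of the keys depends only on the column sums, whereas the third power
sees the joint pattern of three columns. Only invariance is proved; that the values separate the
listed classes is a computation. -/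
theorem classInvariant_eq_of_equivalent (hn : n ≤ 6) {M N : Matrix (Fin n) (Fin n) ℕ}
    (hM : ∀ i j, M i j ≤ 1) (h : Equivalent M N) :
    classInvariant n (rowCodes M) = classInvariant n (rowCodes N) := by
  obtain ⟨σ, τ, rfl⟩ := equivalent_iff.1 h
  rw [classInvariant_rowCodes, classInvariant_rowCodes, ← Equiv.sum_comp (Equiv.mulLeft σ)]
  refine Finset.sum_congr rfl fun ρ _ => ?_
  congr 1
  exact (colKey_eq_iff hn (fun i j => hM _ _) fun i j => hM _ _).2 ⟨τ, rfl⟩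

/-- Project the automorphism group to its row permutations. The fibre over an admissible row
permutation is a coset of the group of column permutations that fix the matrix, so the order is a
product. -/
theorem autOrder_eq (hn : n ≤ 6) {M : Matrix (Fin n) (Fin n) ℕ} (hM : ∀ i j, M i j ≤ 1) :
    autOrder M = autB n (rowCodes M) := by
  classical
  have hT : ∀ i j, M i j < 64 := fun i j => (hM i j).trans_lt (by norm_num)
  have h₁ : (rowCodes M).permutations'.countP
      (fun p => Nat.beq (colKey n p) (colKey n (rowCodes M))) =
      Nat.card {σ : Equiv.Perm (Fin n) // ∃ τ : Equiv.Perm (Fin n), M.submatrix σ τ = M} := by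
    conv_lhs => rw [rowCodes]
    rw [countP_permutations'_ofFn]
    refine Nat.card_congr (Equiv.subtypeEquivRight fun σ => ?_)
    rw [ofFn_pack_comp, Nat.beq_eq]
    exact colKey_eq_iff hn (fun i j => hM _ _) hM
  have h₂ : (colCodes n (rowCodes M)).permutations'.countP (· == colCodes n (rowCodes M)) =
      Nat.card {τ : Equiv.Perm (Fin n) // M.submatrix id τ = M} := by
    rw [colCodes_rowCodes hT]
    conv_lhs => rw [rowCodes]
    rw [countP_permutations'_ofFn]
    refine Nat.card_congr (Equiv.subtypeEquivRight fun τ => ?_)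
    rw [ofFn_pack_comp, beq_iff_eq]
    constructor
    · intro h
      have := rowCodes_injective (fun i j => hT _ _) (fun i j => hT _ _) h
      exact congrArg Matrix.transpose this
    · intro h
      exact congrArg (fun N : Matrix _ _ ℕ => rowCodes N.transpose) h
  rw [autB, h₁, h₂, autOrder, ← Nat.card_prod]
  simp only [permMatrix_mul_mul]
  choose f hf using fun σ : {σ : Equiv.Perm (Fin n) // ∃ τ : Equiv.Perm (Fin n),
    M.submatrix σ τ = M} => σ.2
  -- `f` picks one column permutation for each admissible `σ`; dividing by it leaves a column
  -- permutation that fixes `M`. The inverses of `p.1.2` come from `permMatrix_mul_mul`.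
  refine Nat.card_congr
    { toFun := fun p => (⟨p.1.1, p.1.2.symm, p.2⟩,
        ⟨(f ⟨p.1.1, p.1.2.symm, p.2⟩)⁻¹ * p.1.2.symm, ?_⟩)
      invFun := fun q => ⟨(q.1.1, (f q.1 * q.2.1).symm), ?_⟩
      left_inv := ?_
      right_inv := ?_ }
  · funext i j
    have h₁ := congrFun (congrFun (hf ⟨p.1.1, p.1.2.symm, p.2⟩) i)
      ((f ⟨p.1.1, p.1.2.symm, p.2⟩)⁻¹ (p.1.2.symm j))
    have h₂ := congrFun (congrFun p.2 i) j
    rw [Matrix.submatrix_apply, ← Equiv.Perm.mul_apply, mul_inv_cancel] at h₁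
    exact h₁.symm.trans h₂
  · funext i j
    have h₁ := congrFun (congrFun (hf q.1) i) (q.2.1 j)
    have h₂ := congrFun (congrFun q.2.2 i) j
    simp only [Matrix.submatrix_apply, id] at h₁ h₂
    simpa [Equiv.Perm.mul_apply, Matrix.submatrix_apply] using h₁.trans h₂
  · rintro ⟨⟨σ, τ⟩, h⟩
    simp
  · rintro ⟨⟨σ, h⟩, ⟨τ, h'⟩⟩
    simp

/-! ### Bits -/

/-- The code of a row given by truth values. -/
def bpack (p : Fin n → Bool) : ℕ := pack fun j => (p j).toNat

theorem bpack_succ (p : Fin (n + 1) → Bool) :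
    bpack p = 2 ^ 6 * bpack (fun j => p j.succ) + (p 0).toNat := by
  rw [bpack, bpack, pack, pack, Fin.sum_univ_succ, Finset.mul_sum, add_comm]
  simp only [Fin.val_zero, pow_zero, mul_one, Fin.val_succ, pow_succ]
  congr 1
  exact Finset.sum_congr rfl fun _ _ => by ring

theorem testBit_bpack (p : Fin n → Bool) (k : ℕ) :
    (bpack p).testBit k = if h : k / 6 < n then k % 6 == 0 && p ⟨k / 6, h⟩ else false := by
  induction n generalizing k with
  | zero => simp [bpack, pack]
  | succ n ih =>
    rw [bpack_succ, Nat.testBit_two_pow_mul_add _ (by cases p 0 <;> simp), ih]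
    by_cases hk : k < 6
    · have h0 : k / 6 = 0 := Nat.div_eq_of_lt hk
      simp only [hk, if_true, h0, Nat.zero_lt_succ, dif_pos, Nat.mod_eq_of_lt hk]
      change _ = (k == 0 && p 0)
      rcases Nat.eq_zero_or_pos k with rfl | h
      · cases p 0 <;> simp
      · have h2 : (p 0).toNat < 2 ^ k :=
          (Bool.toNat_lt _).trans_le ((Nat.pow_le_pow_right (by norm_num) h).trans' (by norm_num))
        rw [Nat.testBit_lt_two_pow h2]
        simp [h.ne']
    · have h1 : (k - 6) / 6 + 1 = k / 6 := by omega
      have h2 : (k - 6) % 6 = k % 6 := by omega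
      simp only [hk, if_false, h2, ← h1, Nat.add_lt_add_iff_right]
      rfl

theorem testBit_bpack_mul (p : Fin n → Bool) (j : Fin n) :
    (bpack p).testBit (6 * j) = p j := by
  rw [testBit_bpack, dif_pos (by omega)]
  simp

theorem lor_bpack (p q : Fin n → Bool) : bpack p ||| bpack q = bpack fun j => p j || q j := by
  refine Nat.eq_of_testBit_eq fun k => ?_
  rw [Nat.testBit_or, testBit_bpack, testBit_bpack, testBit_bpack]
  split_ifs <;> simp [Bool.and_or_distrib_left]

theorem land_bpack (p q : Fin n → Bool) : bpack p &&& bpack q = bpack fun j => p j && q j := by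
  refine Nat.eq_of_testBit_eq fun k => ?_
  rw [Nat.testBit_and, testBit_bpack, testBit_bpack, testBit_bpack]
  split_ifs
  · cases k % 6 == 0 <;> simp
  · rfl

theorem bpack_eq_zero {p : Fin n → Bool} : bpack p = 0 ↔ ∀ j, p j = false := by
  simp [bpack, pack, Finset.sum_eq_zero_iff]

/-- Modulo 63 every power of 64 is 1, and the count is at most 6, hence equal to its residue. -/
theorem bpack_mod (hn : n ≤ 6) (p : Fin n → Bool) :
    bpack p % 63 = (Finset.univ.filter fun j => p j = true).card := by
  have h : bpack p ≡ (Finset.univ.filter fun j => p j = true).card [MOD 63] := by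
    rw [Finset.card_filter, bpack, pack]
    refine Nat.ModEq.sum fun j _ => ?_
    have : 64 ^ j.val ≡ 1 ^ j.val [MOD 63] := Nat.ModEq.pow _ (by decide)
    rw [one_pow] at this
    cases p j
    · simp [Nat.ModEq]
    · simpa using this
  exact Nat.mod_eq_of_modEq h
    ((Finset.card_le_univ _).trans_lt (by rw [Fintype.card_fin]; omega))

variable {ι : Type*}

theorem once_map (b : ι → Fin n → Bool) (T : List ι) :
    once (T.map fun i => bpack (b i)) = bpack fun j => decide (1 ≤ T.countP (b · j)) := by
  induction T with
  | nil => simp [once, bpack, pack]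
  | cons i T ih =>
    rw [List.map_cons, once, ih]
    refine (lor_bpack _ _).trans (congrArg bpack (funext fun j => ?_))
    rw [List.countP_cons]
    cases b i j <;> simp

/-- A column has two ones after a row is added exactly if it had two before, or the new row has a
one where some earlier row has one. -/
theorem twice_map (b : ι → Fin n → Bool) (T : List ι) :
    twice (T.map fun i => bpack (b i)) = bpack fun j => decide (2 ≤ T.countP (b · j)) := by
  induction T with
  | nil => simp [twice, bpack, pack]
  | cons i T ih =>
    rw [List.map_cons, twice, ih, once_map]
    refine (congrArg (_ ||| ·) (land_bpack _ _)).trans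
      ((lor_bpack _ _).trans (congrArg bpack (funext fun j => ?_)))
    rw [List.countP_cons]
    cases b i j
    · simp
    · rw [Bool.true_and, ← Bool.decide_or, decide_eq_decide, if_pos rfl]
      omega

/-! ### Sets of rows -/

theorem allSub_map (P : List ℕ → Bool) (f : ι → ℕ) (L S : List ι) :
    allSub P (L.map f) (S.map f) = true ↔
      ∀ T : List ι, T.Sublist L → P ((T.reverse ++ S).map f) = true := by
  induction L generalizing S with
  | nil => simp [allSub]
  | cons i L ih =>
    rw [List.map_cons, allSub, Bool.and_eq_true, ih, ← List.map_cons, ih]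
    constructor
    · rintro ⟨h₁, h₂⟩ T hT
      rcases List.sublist_cons_iff.1 hT with h | ⟨T', rfl, h⟩
      · exact h₁ T h
      · simpa using h₂ T' h
    · intro h
      exact ⟨fun T hT => h T (hT.cons i), fun T hT => by simpa using h _ (hT.cons_cons i)⟩

/-- Each set of indices is listed by exactly one sublist of the increasing index list, so running
through sublists is running through sets. The accumulator reverses the order, which `Q` ignores. -/
theorem allSub_ofFn {P : List ℕ → Bool} {f : Fin n → ℕ} {Q : Finset (Fin n) → Prop}
    (h : ∀ T : List (Fin n), T.Nodup → (P (T.map f) = true ↔ Q T.toFinset)) :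
    allSub P (List.ofFn f) [] = true ↔ ∀ S, Q S := by
  have e := allSub_map P f (List.finRange n) []
  rw [List.map_nil, ← List.ofFn_eq_map] at e
  simp only [List.append_nil] at e
  rw [e]
  constructor
  · intro H S
    have hs : ((List.finRange n).filter (· ∈ S)).Sublist (List.finRange n) := List.filter_sublist
    have hd := (List.nodup_finRange n).sublist hs
    have := (h _ (List.nodup_reverse.2 hd)).1 (H _ hs)
    convert this
    ext i
    simp
  · intro H T hT
    exact (h _ (List.nodup_reverse.2 ((List.nodup_finRange n).sublist hT))).2 (H _)

theorem countP_eq_card {T : List (Fin n)} (hT : T.Nodup) (p : Fin n → Bool) :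
    T.countP p = (T.toFinset.filter fun i => p i = true).card := by
  rw [← List.toFinset_filter, List.toFinset_card_of_nodup (hT.filter _), List.countP_eq_length_filter]

theorem IsZeroOne.le_one {M : Matrix (Fin n) (Fin n) ℕ} (h : IsZeroOne M) (i j : Fin n) :
    M i j ≤ 1 := by
  rcases h i j with h | h <;> omega

theorem IsZeroOne.lt {M : Matrix (Fin n) (Fin n) ℕ} (h : IsZeroOne M) (i j : Fin n) :
    M i j < 64 := (h.le_one i j).trans_lt (by norm_num)

theorem IsZeroOne.transpose {M : Matrix (Fin n) (Fin n) ℕ} (h : IsZeroOne M) :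
    IsZeroOne M.transpose := fun i j => h j i

theorem IsZeroOne.submatrix {M : Matrix (Fin n) (Fin n) ℕ} (h : IsZeroOne M)
    (σ : Fin n → Fin n) (τ : Fin n → Fin n := id) : IsZeroOne (M.submatrix σ τ) :=
  fun i j => h (σ i) (τ j)

theorem IsZeroOne.pack_eq {M : Matrix (Fin n) (Fin n) ℕ} (h : IsZeroOne M) (i : Fin n) :
    pack (M i) = bpack fun j => M i j == 1 := by
  refine congrArg pack (funext fun j => ?_)
  rcases h i j with h | h <;> simp [h]

theorem IsZeroOne.rowCodes_eq {M : Matrix (Fin n) (Fin n) ℕ} (h : IsZeroOne M) :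
    rowCodes M = List.ofFn fun i => bpack fun j => M i j == 1 := by
  rw [rowCodes]
  exact congrArg List.ofFn (funext h.pack_eq)

theorem dotProduct_ne_zero_iff {M : Matrix (Fin n) (Fin n) ℕ} (h : IsZeroOne M) (u v : Fin n) :
    M u ⬝ᵥ M v ≠ 0 ↔ ∃ j, M u j = 1 ∧ M v j = 1 := by
  rw [dotProduct, Ne, Finset.sum_eq_zero_iff]
  push Not
  constructor
  · rintro ⟨j, -, hj⟩
    exact ⟨j, (h u j).resolve_left (left_ne_zero_of_mul hj),
      (h v j).resolve_left (right_ne_zero_of_mul hj)⟩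
  · rintro ⟨j, h₁, h₂⟩
    exact ⟨j, Finset.mem_univ j, by rw [h₁, h₂]; norm_num⟩

/-- A row of `S` is non-orthogonal to another row of `S` exactly if it has a one in a column with at
least two ones in `S`. Both the hypothesis and the conclusion of quadrangularity are therefore read
from the single mask `twice`. -/
theorem rowSQB_iff (hn : n ≤ 6) {M : Matrix (Fin n) (Fin n) ℕ} (h : IsZeroOne M) :
    rowSQB (rowCodes M) = true ↔ IsRowStronglyQuadrangular M := by
  rw [h.rowCodes_eq, rowSQB]
  refine allSub_ofFn fun T hT => ?_
  have hc : ∀ j, T.countP (fun i => M i j == 1) =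
      (T.toFinset.filter fun i => M i j = 1).card := fun j => by
    rw [countP_eq_card hT]
    simp
  have e : ∀ x y : ℕ, Nat.land x y = x &&& y := fun _ _ => rfl
  have e' : ∀ x y : ℕ, Nat.mod x y = x % y := fun _ _ => rfl
  rw [quadSet, twice_map (fun i j => M i j == 1), Bool.or_eq_true, Nat.ble_eq, e', bpack_mod hn,
    List.length_map, List.any_map, List.any_eq_true, List.toFinset_card_of_nodup hT]
  simp only [Function.comp_apply, Nat.beq_eq, e, land_bpack, bpack_eq_zero, hc,
    decide_eq_true_eq]
  rw [or_iff_not_imp_left]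
  refine imp_congr ?_ Iff.rfl
  push Not
  simp only [List.mem_toFinset]
  refine forall₂_congr fun u hu => ?_
  simp only [dotProduct_ne_zero_iff h, Bool.ne_false_iff, Bool.and_eq_true, beq_iff_eq,
    decide_eq_true_eq]
  constructor
  · rintro ⟨j, h₁, h₂⟩
    obtain ⟨v, hv, hne⟩ := Finset.exists_mem_ne (s := T.toFinset.filter fun i => M i j = 1)
      (by omega) u
    rw [Finset.mem_filter, List.mem_toFinset] at hv
    exact ⟨v, hv.1, hne, j, h₁, hv.2⟩
  · rintro ⟨v, hv, hne, j, h₁, h₂⟩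
    refine ⟨j, h₁, Finset.one_lt_card.2 ⟨v, ?_, u, ?_, hne⟩⟩ <;>
    simp [*]

theorem sqB_iff (hn : n ≤ 6) {M : Matrix (Fin n) (Fin n) ℕ} (h : IsZeroOne M) :
    sqB n (rowCodes M) = true ↔ IsSQ M := by
  have hz : ∀ {M : Matrix (Fin n) (Fin n) ℕ}, IsZeroOne M →
      ((rowCodes M).all (· != 0) = true ↔ ∀ i, ∃ j, M i j ≠ 0) := by
    intro M h
    simp only [h.rowCodes_eq, List.all_eq_true, List.forall_mem_ofFn_iff, bne_iff_ne, Ne,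
      bpack_eq_zero]
    push Not
    refine forall_congr' fun i => exists_congr fun j => ?_
    rcases h i j with h | h <;> simp [h]
  rw [sqB, colCodes_rowCodes h.lt]
  simp only [Bool.and_eq_true, hz h, hz h.transpose, rowSQB_iff hn h, rowSQB_iff hn h.transpose]
  rw [IsSQ, IsStronglyQuadrangular, HasNoZeroLine]
  simp only [Matrix.transpose_apply]
  tauto

/-- This is the Hall form of indecomposability: every nonempty proper set of rows meets more columns
than it has members. Otherwise the columns it misses contain enough for a forbidden zero block. -/
theorem indecB_iff (hn : n ≤ 6) {M : Matrix (Fin n) (Fin n) ℕ} (h : IsZeroOne M) :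
    indecB n (rowCodes M) = true ↔ IsIndecomposable M := by
  have key : indecB n (rowCodes M) = true ↔ ∀ S : Finset (Fin n),
      (S.card = 0 ∨ n ≤ S.card) ∨
        S.card < (Finset.univ.filter fun j => ∃ i ∈ S, M i j = 1).card := by
    rw [h.rowCodes_eq, indecB]
    refine allSub_ofFn fun T hT => ?_
    rw [once_map (fun i j => M i j == 1), bpack_mod hn, List.length_map,
      ← List.toFinset_card_of_nodup hT]
    simp [List.one_le_countP_iff]
  rw [key, IsIndecomposable]
  constructor
  · rintro H ⟨R, C, hR, hC, hRC, hz⟩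
    have h₁ := hR.card_pos
    have h₂ := hC.card_pos
    have h₃ : (Finset.univ.filter fun j => ∃ i ∈ R, M i j = 1).card ≤ Cᶜ.card := by
      refine Finset.card_le_card fun j hj => ?_
      rw [Finset.mem_filter] at hj
      obtain ⟨-, i, hi, hij⟩ := hj
      rw [Finset.mem_compl]
      intro hjC
      rw [hz i hi j hjC] at hij
      exact zero_ne_one hij
    rw [Finset.card_compl, Fintype.card_fin] at h₃
    have := H R
    omega
  · intro H S
    by_contra hS
    push Not at hS
    obtain ⟨⟨h₁, h₂⟩, h₃⟩ := hS
    have h₄ : n - S.card ≤ (Finset.univ.filter fun j => ∃ i ∈ S, M i j = 1)ᶜ.card := by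
      rw [Finset.card_compl, Fintype.card_fin]
      omega
    obtain ⟨C, hC, hcard⟩ := Finset.exists_subset_card_eq h₄
    refine H ⟨S, C, Finset.card_pos.1 (by omega), Finset.card_pos.1 (by omega), by omega,
      fun i hi j hj => (h i j).resolve_right fun hij => ?_⟩
    have := hC hj
    rw [Finset.mem_compl] at this
    exact this (Finset.mem_filter.2 ⟨Finset.mem_univ j, i, hi, hij⟩)

/-- Permuting rows and columns of a symmetric matrix simultaneously keeps it symmetric, which allows
the column permutation to be undone. Only row permutations remain to be tried. -/
theorem exists_symm_equivalent_iff {M : Matrix (Fin n) (Fin n) ℕ} :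
    (∃ A, A.IsSymm ∧ Equivalent M A) ↔
      ∃ σ : Equiv.Perm (Fin n), (M.submatrix σ id).IsSymm := by
  constructor
  · rintro ⟨A, hA, h⟩
    obtain ⟨σ, τ, rfl⟩ := equivalent_iff.1 h
    refine ⟨τ.symm.trans σ, ?_⟩
    have := hA.submatrix τ.symm
    rw [Matrix.submatrix_submatrix] at this
    convert this using 2
    · rfl
    · exact τ.self_comp_symm.symm
  · rintro ⟨σ, h⟩
    exact ⟨_, h, equivalent_iff.2 ⟨σ, 1, rfl⟩⟩

theorem symB_iff {M : Matrix (Fin n) (Fin n) ℕ} (h : IsZeroOne M) :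
    symB n (rowCodes M) = true ↔ ∃ A, A.IsSymm ∧ Equivalent M A := by
  rw [exists_symm_equivalent_iff, symB, List.any_eq_true]
  constructor
  · rintro ⟨l, hl, e⟩
    obtain ⟨σ, rfl⟩ := mem_permutations'_ofFn.1 hl
    rw [ofFn_pack_comp, beq_iff_eq, colCodes_rowCodes (h.submatrix σ).lt] at e
    exact ⟨σ, rowCodes_injective (h.submatrix σ).transpose.lt (h.submatrix σ).lt e⟩
  · rintro ⟨σ, e⟩
    refine ⟨_, mem_permutations'_ofFn.2 ⟨σ, rfl⟩, ?_⟩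
    rw [ofFn_pack_comp, beq_iff_eq, colCodes_rowCodes (h.submatrix σ).lt, e]

/-! ### Invariance under equivalence -/

theorem IsRowStronglyQuadrangular.submatrix {M : Matrix (Fin n) (Fin n) ℕ}
    (h : IsRowStronglyQuadrangular M) (σ τ : Equiv.Perm (Fin n)) :
    IsRowStronglyQuadrangular (M.submatrix σ τ) := by
  intro S hS
  have hdot : ∀ u v, M.submatrix σ τ u ⬝ᵥ M.submatrix σ τ v = M (σ u) ⬝ᵥ M (σ v) := fun u v =>
    Equiv.sum_comp τ fun j => M (σ u) j * M (σ v) j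
  have := h (S.map σ.toEmbedding) (by
    simp only [Finset.mem_map, Equiv.coe_toEmbedding, forall_exists_index, and_imp]
    rintro _ u hu rfl
    obtain ⟨v, hv, hne, hd⟩ := hS u hu
    exact ⟨_, ⟨v, hv, rfl⟩, σ.injective.ne hne, by rwa [hdot] at hd⟩)
  rw [Finset.card_map] at this
  refine this.trans_eq ?_
  rw [← Finset.card_map τ.symm.toEmbedding]
  congr 1
  ext j
  rw [Finset.mem_map, Finset.mem_filter]
  simp only [Finset.mem_filter, Finset.mem_univ, true_and, Equiv.coe_toEmbedding,
    Matrix.submatrix_apply, Finset.filter_map, Finset.card_map, Function.comp_def]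
  constructor
  · rintro ⟨k, hk, rfl⟩
    simpa using hk
  · intro hj
    exact ⟨τ j, hj, by simp⟩

theorem IsSQ.of_equivalent {M N : Matrix (Fin n) (Fin n) ℕ} (h : IsSQ M) (e : Equivalent M N) :
    IsSQ N := by
  obtain ⟨σ, τ, rfl⟩ := equivalent_iff.1 e
  obtain ⟨⟨h₁, h₂, h₃⟩, h₄, h₅⟩ := h
  refine ⟨⟨fun i j => h₁ _ _, h₂.submatrix σ τ, h₃.submatrix τ σ⟩, fun i => ?_, fun j => ?_⟩
  · obtain ⟨j, hj⟩ := h₄ (σ i)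
    exact ⟨τ.symm j, by simpa using hj⟩
  · obtain ⟨i, hi⟩ := h₅ (τ j)
    exact ⟨σ.symm i, by simpa using hi⟩

theorem IsIndecomposable.of_equivalent {M N : Matrix (Fin n) (Fin n) ℕ} (h : IsIndecomposable M)
    (e : Equivalent M N) : IsIndecomposable N := by
  obtain ⟨σ, τ, rfl⟩ := equivalent_iff.1 e
  rintro ⟨R, C, hR, hC, hRC, hz⟩
  refine h ⟨R.map σ.toEmbedding, C.map τ.toEmbedding, hR.map, hC.map, by simpa using hRC, ?_⟩
  simp only [Finset.mem_map, Equiv.coe_toEmbedding, forall_exists_index, and_imp]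
  rintro _ i hi rfl _ j hj rfl
  exact hz i hi j hj

theorem IsRegularOf.of_equivalent {k : ℕ} {M N : Matrix (Fin n) (Fin n) ℕ} (h : IsRegularOf k M)
    (e : Equivalent M N) : IsRegularOf k N := by
  obtain ⟨σ, τ, rfl⟩ := equivalent_iff.1 e
  exact ⟨fun i => (Equiv.sum_comp τ fun j => M (σ i) j).trans (h.1 _),
    fun j => (Equiv.sum_comp σ fun i => M i (τ j)).trans (h.2 _)⟩

/-! ### The search -/

/-- Rows are put in front, so the first choice of the search is the last row of the matrix; the
induction accordingly peels `t` from its end. -/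
theorem search_sound {cand : List ℕ} {ok : List ℕ → ℕ → Bool} {leaf : List ℕ → Bool} {k : ℕ}
    {l : List ℕ} (h : search cand ok leaf k l = true) (t : List ℕ) (hk : t.length = k)
    (hc : ∀ r ∈ t, r ∈ cand) (hok : ∀ r s, (r :: s) <:+ t ++ l → ok s r = true) :
    leaf (t ++ l) = true := by
  induction k generalizing l t with
  | zero =>
    rw [List.length_eq_zero_iff] at hk
    subst hk
    exact h
  | succ k ih =>
    obtain ⟨t', r, rfl⟩ : ∃ t' r, t = t' ++ [r] := by
      rcases List.eq_nil_or_concat t with rfl | ⟨t', r, h⟩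
      · simp at hk
      · exact ⟨t', r, by simpa using h⟩
    rw [search, List.all_eq_true] at h
    have h' := h r (hc r (by simp))
    rw [List.append_assoc, List.singleton_append] at hok ⊢
    rw [hok r l (List.suffix_append _ _), Bool.not_true, Bool.false_or] at h'
    exact ih h' t' (by simpa using hk) (fun x hx => hc x (by simp [hx])) hok

theorem pack_mod {a : Fin n → ℕ} (h : ∑ j, a j < 63) : pack a % 63 = ∑ j, a j := by
  refine Nat.mod_eq_of_modEq (Nat.ModEq.sum fun j _ => ?_) h
  have : 64 ^ j.val ≡ 1 ^ j.val [MOD 63] := Nat.ModEq.pow _ (by decide)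
  simpa using this.mul_left (a j)

theorem IsZeroOne.sum_row_le {M : Matrix (Fin n) (Fin n) ℕ} (h : IsZeroOne M) (i : Fin n) :
    ∑ j, M i j ≤ n := by
  simpa using Finset.sum_le_card_nsmul Finset.univ (M i) 1 fun j _ => h.le_one i j

theorem pack_mem_allCodes {a : Fin n → ℕ} (h : ∀ j, a j = 0 ∨ a j = 1) : pack a ∈ allCodes n := by
  induction n with
  | zero => simp [allCodes, pack]
  | succ n ih =>
    have e : pack a = pack (fun j : Fin n => a j.succ) * 64 + a 0 := by
      rw [pack_mul, pack, Fin.sum_univ_succ, pack, add_comm]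
      simp only [Fin.val_zero, pow_zero, mul_one, Fin.val_succ, pow_succ]
      congr 1
      exact Finset.sum_congr rfl fun _ _ => by ring
    rw [allCodes, List.mem_flatMap]
    refine ⟨_, ih fun j => h j.succ, ?_⟩
    rw [e]
    rcases h 0 with h | h <;> simp [h]

/-! ### Sorted representatives and the pruning of the search -/

theorem exists_sorted (M : Matrix (Fin n) (Fin n) ℕ) : ∃ N, Equivalent M N ∧
    Monotone (fun i => ∑ j, N i j) ∧ Monotone fun j => ∑ i, N i j * 2 ^ i.val := by
  -- The rows come first: the later sorting of columns does not disturb row sums, while sorting rows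
  -- would change the column codes.
  let σ := Tuple.sort fun i => ∑ j, M i j
  let τ := Tuple.sort fun j => ∑ i, M (σ i) j * 2 ^ i.val
  refine ⟨M.submatrix σ τ, equivalent_iff.2 ⟨σ, τ, rfl⟩, ?_,
    Tuple.monotone_sort fun j => ∑ i, M (σ i) j * 2 ^ i.val⟩
  have : (fun i => ∑ j, M.submatrix σ τ i j) = (fun i => ∑ j, M i j) ∘ σ :=
    funext fun i => Equiv.sum_comp τ fun j => M (σ i) j
  rw [this]
  exact Tuple.monotone_sort _

/-- This is comparison at the leading differing place. The last row carries the highest power of 2,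
which is why the sorting of columns can be tested while the matrix is built from below. -/
theorem le_of_colCode_le {a b : Fin n → ℕ} (hb : ∀ i, b i ≤ 1)
    (h : ∑ i, a i * 2 ^ i.val ≤ ∑ i, b i * 2 ^ i.val) (i : Fin n)
    (hi : ∀ k, i < k → a k = b k) : a i ≤ b i := by
  by_contra hab
  push Not at hab
  -- If `a i` exceeded `b i`, then `a` would win at least `2 ^ i` at place `i`, while `b` can regain
  -- at most the sum of the lower powers of 2, which is smaller.
  have h₁ : ∑ k, (b k * 2 ^ k.val + if k = i then 2 ^ i.val else 0) ≤
      ∑ k, (a k * 2 ^ k.val + if k < i then 2 ^ k.val else 0) := by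
    refine Finset.sum_le_sum fun k _ => ?_
    rcases lt_trichotomy k i with hk | rfl | hk
    · rw [if_neg hk.ne, if_pos hk]
      have := Nat.mul_le_mul_right (2 ^ k.val) (hb k)
      omega
    · rw [if_pos rfl, if_neg (lt_irrefl _)]
      have := Nat.mul_le_mul_right (2 ^ k.val) (Nat.succ_le_of_lt hab)
      rw [Nat.succ_mul] at this
      exact this
    · rw [if_neg hk.ne', if_neg hk.not_gt, hi k hk]
  have h₂ : ∑ k : Fin n, (if k < i then 2 ^ k.val else 0) < 2 ^ i.val := by
    have := Fin.sum_univ_eq_sum_range (fun k => if k < i.val then 2 ^ k else 0) n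
    simp only [Fin.lt_def]
    rw [this, ← Finset.sum_filter]
    exact Nat.geomSum_lt le_rfl fun k hk => (Finset.mem_filter.1 hk).2
  rw [Finset.sum_add_distrib, Finset.sum_add_distrib, Finset.sum_ite_eq' Finset.univ i] at h₁
  simp only [Finset.mem_univ, if_true] at h₁
  omega

/-- Bit `6 * j` of the mask says that columns `j` and `j + 1` agree in all rows of `s`: shifting by
one digit aligns neighbours, and the exclusive or with ones turns difference into equality. -/
theorem testBit_eqMask {s : List ℕ} {k : ℕ} (h : (eqMask n s).testBit k = true) :
    k % 6 = 0 ∧ k / 6 + 1 < n ∧ ∀ x ∈ s, x.testBit k = x.testBit (6 + k) := by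
  have full : ∀ m : ℕ, (pack fun _ : Fin m => 1) = bpack fun _ : Fin m => true := fun _ => rfl
  induction s with
  | nil =>
    rw [eqMask, full, testBit_bpack] at h
    split_ifs at h with hk
    · simp only [Bool.and_true, beq_iff_eq] at h
      exact ⟨h, by omega, by simp⟩
  | cons r s ih =>
    rw [eqMask, Nat.testBit_and, Bool.and_eq_true] at h
    obtain ⟨h₁, h₂, h₃⟩ := ih h.1
    refine ⟨h₁, h₂, fun x hx => ?_⟩
    rcases List.mem_cons.1 hx with rfl | hx
    · have := h.2
      rw [Nat.testBit_xor, Nat.testBit_xor, Nat.testBit_shiftRight, full, testBit_bpack,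
        dif_pos (by omega), h₁] at this
      revert this
      cases x.testBit k <;> cases x.testBit (6 + k) <;> simp
    · exact h₃ x hx

theorem IsZeroOne.testBit_pack {M : Matrix (Fin n) (Fin n) ℕ} (h : IsZeroOne M) (i j : Fin n) :
    (pack (M i)).testBit (6 * j) = (M i j == 1) := by
  rw [h.pack_eq, testBit_bpack_mul]

/-- Quadrangularity for the pair `{u, v}`: once the rows share a column, at least two columns must
have ones in both. -/
theorem IsRowStronglyQuadrangular.land_mod_ne_one {M : Matrix (Fin n) (Fin n) ℕ}
    (h : IsRowStronglyQuadrangular M) (hn : n ≤ 6) (hM : IsZeroOne M) {u v : Fin n}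
    (huv : u ≠ v) : (pack (M u) &&& pack (M v)) % 63 ≠ 1 := by
  rw [hM.pack_eq, hM.pack_eq, land_bpack, bpack_mod hn]
  intro hc
  obtain ⟨j, hj⟩ := Finset.card_pos.1 (hc ▸ Nat.one_pos)
  simp only [Finset.mem_filter, Bool.and_eq_true, beq_iff_eq] at hj
  have := h {u, v} (by
    intro x hx
    rcases Finset.mem_insert.1 hx with rfl | hx
    · exact ⟨v, by simp, huv.symm, (dotProduct_ne_zero_iff hM _ _).2 ⟨j, hj.2⟩⟩
    · rw [Finset.mem_singleton] at hx
      subst hx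
      exact ⟨u, by simp, huv, (dotProduct_ne_zero_iff hM _ _).2 ⟨j, hj.2.symm⟩⟩)
  rw [Finset.card_pair huv] at this
  have hle := Finset.card_le_card (s := Finset.univ.filter fun j =>
    2 ≤ (({u, v} : Finset (Fin n)).filter fun i => M i j = 1).card)
    (t := Finset.univ.filter fun j => (M u j == 1 && M v j == 1) = true) (by
      intro k hk
      rw [Finset.mem_filter] at hk ⊢
      refine ⟨hk.1, ?_⟩
      have he : ({u, v} : Finset (Fin n)).filter (fun i => M i k = 1) = {u, v} :=
        Finset.eq_of_subset_of_card_le (Finset.filter_subset _ _)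
          (by rw [Finset.card_pair huv]; exact hk.2)
      have hu : u ∈ ({u, v} : Finset (Fin n)).filter (fun i => M i k = 1) := by rw [he]; simp
      have hv : v ∈ ({u, v} : Finset (Fin n)).filter (fun i => M i k = 1) := by rw [he]; simp
      simp [(Finset.mem_filter.1 hu).2, (Finset.mem_filter.1 hv).2])
  omega

theorem mayExtend_of_sorted (hn : n ≤ 6) {M : Matrix (Fin n) (Fin n) ℕ} (h : IsSQ M)
    (hr : Monotone fun i => ∑ j, M i j) (hc : Monotone fun j => ∑ i, M i j * 2 ^ i.val)
    {i : Fin n} {t : List (Fin n)} (ht : ∀ k, k ∈ t ↔ i < k) :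
    mayExtend n (t.map fun i => pack (M i)) (pack (M i)) = true := by
  have hM := h.1.1
  rw [mayExtend, Bool.and_eq_true]
  constructor
  · rw [beq_iff_eq]
    refine Nat.eq_of_testBit_eq fun k => ?_
    rw [Nat.testBit_and, Nat.testBit_and, Nat.testBit_shiftRight, Bool.and_eq_left_iff_imp,
      Bool.and_eq_true]
    rintro ⟨h₁, h₂⟩
    obtain ⟨h₃, h₄, h₅⟩ := testBit_eqMask h₂
    obtain ⟨j, rfl⟩ : ∃ j, k = 6 * j := ⟨k / 6, by omega⟩
    rw [Nat.mul_div_cancel_left j (by norm_num)] at h₄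
    have e : 6 + 6 * j = 6 * (j + 1) := by ring
    rw [e] at h₅ ⊢
    let j₁ : Fin n := ⟨j, by omega⟩
    let j₂ : Fin n := ⟨j + 1, h₄⟩
    have b₁ : ∀ i, (pack (M i)).testBit (6 * j) = (M i j₁ == 1) := fun i => hM.testBit_pack i j₁
    have b₂ : ∀ i, (pack (M i)).testBit (6 * (j + 1)) = (M i j₂ == 1) :=
      fun i => hM.testBit_pack i j₂
    rw [b₂, beq_iff_eq]
    rw [b₁, beq_iff_eq] at h₁
    have hle : M i j₁ ≤ M i j₂ := le_of_colCode_le (a := fun i => M i j₁) (b := fun i => M i j₂)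
      (fun i => hM.le_one _ _) (hc (Fin.le_def.2 (Nat.le_succ j))) i (by
        intro k hk
        have := h₅ _ (List.mem_map.2 ⟨k, (ht k).2 hk, rfl⟩)
        rw [b₁, b₂, Bool.eq_iff_iff, beq_iff_eq, beq_iff_eq] at this
        rcases hM k j₁ with h₁ | h₁ <;> rcases hM k j₂ with h₂ | h₂ <;> simp_all)
    have := hM.le_one i j₂
    omega
  · rw [List.all_eq_true]
    intro x hx
    obtain ⟨k, hk, rfl⟩ := List.mem_map.1 hx
    have hik := (ht k).1 hk
    have lt : ∀ i, ∑ j, M i j < 63 := fun i => (hM.sum_row_le i).trans_lt (by omega)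
    rw [Bool.and_eq_true, Nat.ble_eq, bne_iff_ne, pack_mod (lt _), pack_mod (lt _)]
    exact ⟨hr hik.le, h.1.2.1.land_mod_ne_one hn hM hik.ne⟩

theorem exists_equivalent_of_searchSQ (hn : n ≤ 6) {cand : List ℕ} {extra : List ℕ → ℕ → Bool}
    {L : List (Matrix (Fin n) (Fin n) ℕ)} (hL : ∀ A ∈ L, IsZeroOne A)
    (hs : searchSQ n cand extra (L.map fun A => colKey n (rowCodes A)) = true)
    {M : Matrix (Fin n) (Fin n) ℕ} (hM : IsSQ M)
    (hcand : ∀ N, Equivalent M N → ∀ i, pack (N i) ∈ cand)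
    (hextra : ∀ N, Equivalent M N → ∀ i t, (i :: t).Nodup →
      extra (t.map fun i => pack (N i)) (pack (N i)) = true) :
    ∃ A ∈ L, Equivalent M A := by
  obtain ⟨N, hMN, hr, hc⟩ := exists_sorted M
  have hN := hM.of_equivalent hMN
  have e : rowCodes N = (List.finRange n).map fun i => pack (N i) := List.ofFn_eq_map
  have := search_sound hs (rowCodes N) (by simp [rowCodes])
    (by simpa [rowCodes, List.forall_mem_ofFn_iff] using hcand N hMN) (by
      intro r s hrs
      rw [List.append_nil, e] at hrs
      obtain ⟨p, hp⟩ := hrs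
      obtain ⟨p', q, hpq, rfl, hq⟩ := List.append_eq_map_iff.1 hp
      obtain ⟨i, t, rfl, rfl, rfl⟩ := List.map_eq_cons_iff.1 hq
      have hlt : (p' ++ i :: t).Pairwise (· < ·) := hpq ▸ List.pairwise_lt_finRange n
      rw [List.pairwise_append, List.pairwise_cons] at hlt
      -- The row indices are listed in increasing order, so the rows below `i` in the list are
      -- exactly those of larger index.
      have ht : ∀ k, k ∈ t ↔ i < k := by
        intro k
        refine ⟨hlt.2.1.1 k, fun hk => ?_⟩
        have hmem : k ∈ p' ++ i :: t := hpq ▸ List.mem_finRange k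
        rcases List.mem_append.1 hmem with h | h
        · exact absurd (hlt.2.2 k h i (by simp)) hk.not_gt
        · exact (List.mem_cons.1 h).resolve_left hk.ne'
      rw [Bool.and_eq_true]
      refine ⟨mayExtend_of_sorted hn hN hr hc ht, hextra N hMN i t ?_⟩
      exact (hpq ▸ List.nodup_finRange n : (p' ++ i :: t).Nodup).of_append_right)
  rw [List.append_nil, (sqB_iff hn hN.1.1).2 hN, Bool.not_true, Bool.false_or,
    List.any_eq_true] at this
  obtain ⟨l, hl, hk⟩ := this
  obtain ⟨A, hA, hk⟩ := List.mem_map.1 (List.elem_iff.1 hk)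
  exact ⟨A, hA, equivalent_trans hMN ((equivalent_iff_colKey hn hN.1.1.le_one (hL A hA).le_one).2
    ⟨l, hl, hk.symm⟩)⟩

/-- The rows still missing contribute to each column at least 0 and at most their number. -/
theorem colSums_of_regular {w : ℕ} {M : Matrix (Fin n) (Fin n) ℕ} (hM : IsZeroOne M)
    (hn : n ≤ 6) (h : IsRegularOf w M) {i : Fin n} {t : List (Fin n)} (ht : (i :: t).Nodup) :
    colSums n w (t.map fun i => pack (M i)) (pack (M i)) = true := by
  rw [colSums, List.all_eq_true]
  intro j hj
  rw [List.mem_range] at hj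
  have e : (pack (M i) :: t.map fun i => pack (M i)).sum =
      pack fun j => ∑ k ∈ (i :: t).toFinset, M k j := by
    refine Eq.trans ?_ (sum_pack (i :: t).toFinset fun k j => M k j)
    rw [List.sum_toFinset _ ht]
    rfl
  have le : ∀ s : Finset (Fin n), ∀ j, ∑ k ∈ s, M k j ≤ s.card := fun s j => by
    simpa using Finset.sum_le_card_nsmul s (fun k => M k j) 1 fun k _ => hM.le_one k j
  have hcard : ∀ s : Finset (Fin n), s.card ≤ n := fun s => by simpa using Finset.card_le_univ s
  have hd := digit_pack (a := fun j => ∑ k ∈ (i :: t).toFinset, M k j)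
    (fun j => ((le _ j).trans (hcard _)).trans_lt (by omega)) ⟨j, hj⟩
  simp only at hd
  rw [e, hd, Bool.and_eq_true, Nat.ble_eq, Nat.ble_eq, List.length_map]
  have hsum := Finset.sum_add_sum_compl (i :: t).toFinset fun k => M k ⟨j, hj⟩
  rw [h.2] at hsum
  have := le (i :: t).toFinsetᶜ ⟨j, hj⟩
  rw [Finset.card_compl, Fintype.card_fin, List.toFinset_card_of_nodup ht,
    List.length_cons] at this
  omega

/-! ### Complete lists -/

instance (M : Matrix (Fin n) (Fin n) ℕ) : Decidable (IsZeroOne M) :=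
  (fun f : Fin n → Fin n → ℕ => (inferInstance : Decidable (∀ i j, f i j = 0 ∨ f i j = 1))) M

theorem pairwise_not_equivalent (hn : n ≤ 6) {L : List (Matrix (Fin n) (Fin n) ℕ)}
    (hz : ∀ A ∈ L, IsZeroOne A)
    (h : (L.map fun A => classInvariant n (rowCodes A)).Pairwise (· ≠ ·)) :
    L.Pairwise fun A B => ¬ Equivalent A B :=
  (List.pairwise_map.1 h).imp_of_mem fun hA _ h e =>
    h (classInvariant_eq_of_equivalent hn (hz _ hA).le_one e)

theorem isCompleteList_isSQ (hn : n ≤ 6) {L : List (Matrix (Fin n) (Fin n) ℕ)}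
    (hz : ∀ A ∈ L, IsZeroOne A) (hsq : (L.all fun A => sqB n (rowCodes A)) = true)
    (hinv : (L.map fun A => classInvariant n (rowCodes A)).Pairwise (· ≠ ·))
    (hs : searchSQ n (allCodes n) (fun _ _ => true)
      (L.map fun A => colKey n (rowCodes A)) = true) :
    IsCompleteList IsSQ L := by
  refine ⟨fun A hA => (sqB_iff hn (hz A hA)).1 (List.all_eq_true.1 hsq A hA),
    pairwise_not_equivalent hn hz hinv, fun M hM => ?_⟩
  exact exists_equivalent_of_searchSQ hn hz hs hM
    (fun N e i => pack_mem_allCodes ((hM.of_equivalent e).1.1 i)) fun _ _ _ _ _ => rfl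

/-- Decision procedure for `IsRegularOf`. -/
def regOfB (n k : ℕ) (l : List ℕ) : Bool :=
  l.all (· % 63 == k) && (colCodes n l).all (· % 63 == k)

theorem regOfB_iff (hn : n ≤ 6) {k : ℕ} {M : Matrix (Fin n) (Fin n) ℕ} (h : IsZeroOne M) :
    regOfB n k (rowCodes M) = true ↔ IsRegularOf k M := by
  have key : ∀ {M : Matrix (Fin n) (Fin n) ℕ}, IsZeroOne M →
      ((rowCodes M).all (· % 63 == k) = true ↔ ∀ i, ∑ j, M i j = k) := by
    intro M h
    simp only [rowCodes, List.all_eq_true, List.forall_mem_ofFn_iff, beq_iff_eq]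
    exact forall_congr' fun i => by rw [pack_mod ((h.sum_row_le i).trans_lt (by omega))]
  rw [regOfB, colCodes_rowCodes h.lt, Bool.and_eq_true, key h, key h.transpose]
  rfl

/-- Decision procedure for `IsRegular`. -/
def regB (n : ℕ) (l : List ℕ) : Bool :=
  (List.range (n + 1)).any fun k => regOfB n k l

theorem regB_iff (hn : 0 < n) (hn' : n ≤ 6) {M : Matrix (Fin n) (Fin n) ℕ} (h : IsZeroOne M) :
    regB n (rowCodes M) = true ↔ IsRegular M := by
  rw [regB, List.any_eq_true]
  simp only [regOfB_iff hn' h, List.mem_range]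
  constructor
  · rintro ⟨k, -, hk⟩
    exact ⟨k, hk⟩
  · rintro ⟨k, hk⟩
    exact ⟨k, by rw [← hk.1 ⟨0, hn⟩]; exact Nat.lt_succ_of_le (h.sum_row_le _), hk⟩

theorem isCompleteList_isRegularOf (hn : n ≤ 6) {w : ℕ}
    {L : List (Matrix (Fin n) (Fin n) ℕ)} (hz : ∀ A ∈ L, IsZeroOne A)
    (hsq : (L.all fun A => sqB n (rowCodes A)) = true)
    (hw : (L.all fun A => regOfB n w (rowCodes A)) = true)
    (hinv : L.Pairwise fun A B => ¬ Equivalent A B)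
    (hs : searchSQ n ((allCodes n).filter (· % 63 == w)) (colSums n w)
      (L.map fun A => colKey n (rowCodes A)) = true) :
    IsCompleteList (fun M => IsSQ M ∧ IsRegularOf w M) L := by
  refine ⟨fun A hA => ⟨(sqB_iff hn (hz A hA)).1 (List.all_eq_true.1 hsq A hA),
    (regOfB_iff hn (hz A hA)).1 (List.all_eq_true.1 hw A hA)⟩, hinv, fun M hM => ?_⟩
  refine exists_equivalent_of_searchSQ hn hz hs hM.1 (fun N e i => ?_) fun N e i t ht =>
    colSums_of_regular (hM.1.of_equivalent e).1.1 hn (hM.2.of_equivalent e) ht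
  have hN := (hM.1.of_equivalent e).1.1
  rw [List.mem_filter, pack_mod ((hN.sum_row_le i).trans_lt (by omega)),
    (hM.2.of_equivalent e).1, beq_self_eq_true]
  exact ⟨pack_mem_allCodes (hN i), rfl⟩

/-! ### Restricting complete lists and counting classes -/

theorem IsCompleteList.and_of_append {p q : Matrix (Fin n) (Fin n) ℕ → Prop}
    {L₁ L₂ : List (Matrix (Fin n) (Fin n) ℕ)} (h : IsCompleteList p (L₁ ++ L₂))
    (h₁ : ∀ A ∈ L₁, q A) (h₂ : ∀ A ∈ L₂, ¬ q A)
    (hq : ∀ {M N}, q M → Equivalent M N → q N) :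
    IsCompleteList (fun M => p M ∧ q M) L₁ := by
  refine ⟨fun A hA => ⟨h.1 A (List.mem_append_left _ hA), h₁ A hA⟩,
    (List.pairwise_append.1 h.2.1).1, fun M hM => ?_⟩
  obtain ⟨A, hA, e⟩ := h.2.2 M hM.1
  exact ⟨A, (List.mem_append.1 hA).resolve_right fun hA => h₂ A hA (hq hM.2 e), e⟩

/-- The property `p'` need not be invariant under equivalence; symmetry is not. So `b` tests whether
the class of a listed matrix contains a matrix with `p'`. -/
theorem IsCompleteList.numClasses_eq {p p' : Matrix (Fin n) (Fin n) ℕ → Prop}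
    {L : List (Matrix (Fin n) (Fin n) ℕ)} (h : IsCompleteList p L) (hp : ∀ M, p' M → p M)
    {b : Matrix (Fin n) (Fin n) ℕ → Bool}
    (hb : ∀ A ∈ L, b A = true ↔ ∃ M, Equivalent A M ∧ p' M) :
    numClasses p' = L.countP b := by
  classical
  have hs : {c : Quotient (equivSetoid n) | ∃ M, p' M ∧ Quotient.mk (equivSetoid n) M = c} =
      ((L.filter b).map (Quotient.mk (equivSetoid n))).toFinset := by
    ext c
    simp only [Set.mem_ofPred_eq, List.coe_toFinset, List.mem_map, List.mem_filter]
    constructor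
    · rintro ⟨M, hM, rfl⟩
      obtain ⟨A, hA, e⟩ := h.2.2 M (hp M hM)
      exact ⟨A, ⟨hA, (hb A hA).2 ⟨M, equivalent_symm e, hM⟩⟩,
        Quotient.sound (equivalent_symm e)⟩
    · rintro ⟨A, ⟨hA, hbA⟩, rfl⟩
      obtain ⟨M, e, hM⟩ := (hb A hA).1 hbA
      exact ⟨M, hM, Quotient.sound (equivalent_symm e)⟩
  have hd : ((L.filter b).map (Quotient.mk (equivSetoid n))).Nodup := by
    refine List.pairwise_map.2 ((h.2.1.sublist List.filter_sublist).imp fun hAB e => hAB ?_)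
    exact Quotient.exact e
  rw [numClasses, hs, Set.ncard_coe_finset, List.toFinset_card_of_nodup hd, List.length_map,
    List.countP_eq_length_filter]

theorem IsCompleteList.numClasses_eq_length {p : Matrix (Fin n) (Fin n) ℕ → Prop}
    {L : List (Matrix (Fin n) (Fin n) ℕ)} (h : IsCompleteList p L) :
    numClasses p = L.length := by
  rw [h.numClasses_eq (b := fun _ => true) (fun _ hM => hM)
    fun A hA => ⟨fun _ => ⟨A, equivalent_refl A, h.1 A hA⟩, fun _ => rfl⟩, List.countP_true]

theorem IsCompleteList.numClasses_and_isSymm {p : Matrix (Fin n) (Fin n) ℕ → Prop}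
    {L : List (Matrix (Fin n) (Fin n) ℕ)} (h : IsCompleteList p L) (hz : ∀ A ∈ L, IsZeroOne A)
    (hp : ∀ {M N}, p M → Equivalent M N → p N) :
    numClasses (fun M => p M ∧ M.IsSymm) = L.countP fun A => symB n (rowCodes A) := by
  refine h.numClasses_eq (fun _ hM => hM.1) fun A hA => ?_
  rw [symB_iff (hz A hA)]
  exact ⟨fun ⟨M, hM, e⟩ => ⟨M, e, hp (h.1 A hA) e, hM⟩, fun ⟨M, e, hM⟩ => ⟨M, hM.2, e⟩⟩

theorem IsRegular.of_equivalent {M N : Matrix (Fin n) (Fin n) ℕ} (h : IsRegular M)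
    (e : Equivalent M N) : IsRegular N :=
  h.imp fun _ hk => hk.of_equivalent e

theorem IsCompleteList.numClasses_and_isRegular (hn : 0 < n) (hn' : n ≤ 6)
    {p : Matrix (Fin n) (Fin n) ℕ → Prop}
    {L : List (Matrix (Fin n) (Fin n) ℕ)} (h : IsCompleteList p L) (hz : ∀ A ∈ L, IsZeroOne A) :
    numClasses (fun M => p M ∧ IsRegular M) = L.countP fun A => regB n (rowCodes A) := by
  refine h.numClasses_eq (fun _ hM => hM.1) fun A hA => ?_
  rw [regB_iff hn hn' (hz A hA)]
  exact ⟨fun hr => ⟨A, equivalent_refl A, h.1 A hA, hr⟩,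
    fun ⟨M, e, hM⟩ => hM.2.of_equivalent (equivalent_symm e)⟩

/-! ### Matrices that do not support unitaries -/

/-- Some row meets the supports of the rows `p` and `q` in the two columns `a` and `b` only. -/
def IsLink (M : Fin n → Fin n → ℕ) (p q a b : Fin n) : Prop :=
  M p a = 1 ∧ a ≠ b ∧ ∃ k, k ≠ p ∧ k ≠ q ∧ M k a = 1 ∧ M k b = 1 ∧
    ∀ j, j ≠ a → j ≠ b → M k j = 1 → M p j = 0 ∧ M q j = 0

/-- All columns that meet the rows `p` and `q` are joined to one column by at most two links. -/
def HasLinkedRows (M : Fin n → Fin n → ℕ) : Prop :=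
  ∃ p q j₀, p ≠ q ∧ M p j₀ = 1 ∧ M q j₀ = 1 ∧ ∀ j, (M p j = 0 ∧ M q j = 0) ∨ j = j₀ ∨
    IsLink M p q j₀ j ∨ ∃ m, IsLink M p q j₀ m ∧ IsLink M p q m j

instance (M : Fin n → Fin n → ℕ) (p q a b : Fin n) : Decidable (IsLink M p q a b) := by
  unfold IsLink; infer_instance

instance (M : Fin n → Fin n → ℕ) : Decidable (HasLinkedRows M) := by
  unfold HasLinkedRows; infer_instance

/-- Orthogonality of the linking row to rows `p` and `q` has only two terms, in columns `a` and `b`,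
so the two rows are proportional on these columns. Links to a common column make them proportional
throughout, which contradicts their orthogonality. -/
theorem HasLinkedRows.not_supportsUnitary {M : Matrix (Fin n) (Fin n) ℕ} (h : HasLinkedRows M) :
    ¬ SupportsUnitary M := by
  rintro ⟨U, hU, hs⟩
  obtain ⟨p, q, j₀, hpq, hp, hq, hj⟩ := h
  have hz : ∀ {i j}, M i j = 0 → U i j = 0 := fun {i j} h => by
    by_contra hne
    rw [(hs i j).1 hne] at h
    exact one_ne_zero h
  have horth : ∀ i k, ∑ j, U i j * star (U k j) = if i = k then 1 else 0 := fun i k => by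
    have := congrFun (congrFun (Matrix.mem_unitaryGroup_iff.1 hU) i) k
    rwa [Matrix.mul_apply, Matrix.one_apply] at this
  have link : ∀ {a b}, IsLink M p q a b → U p a * U q b = U p b * U q a := by
    rintro a b ⟨-, hab, k, hkp, hkq, hka, hkb, hk⟩
    have two : ∀ i, i ≠ k → (∀ j, j ≠ a → j ≠ b → M k j = 1 → M i j = 0) →
        U i a * star (U k a) + U i b * star (U k b) = 0 := by
      intro i hik hi
      have := horth i k
      rw [if_neg hik] at this
      rw [← this, ← Finset.sum_pair (f := fun j => U i j * star (U k j)) hab]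
      refine Finset.sum_subset (Finset.subset_univ _) fun j _ hj => ?_
      simp only [Finset.mem_insert, Finset.mem_singleton, not_or] at hj
      by_cases hkj : M k j = 1
      · rw [hz (hi j hj.1 hj.2 hkj), zero_mul]
      · have : U k j = 0 := by
          by_contra hne
          exact hkj ((hs k j).1 hne)
        rw [this, star_zero, mul_zero]
    have h₁ := two p hkp.symm fun j ha hb hkj => (hk j ha hb hkj).1
    have h₂ := two q hkq.symm fun j ha hb hkj => (hk j ha hb hkj).2
    have hne : star (U k b) ≠ 0 := star_ne_zero.2 ((hs k b).2 hkb)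
    refine mul_right_cancel₀ hne ?_
    -- This combination of the two orthogonality relations eliminates the entry of row `k` in column
    -- `a`.
    linear_combination U p a * h₂ - U q a * h₁
  have hprop : ∀ j, U p j * U q j₀ = U p j₀ * U q j := by
    intro j
    rcases hj j with ⟨h₁, h₂⟩ | rfl | h | ⟨m, h₁, h₂⟩
    · rw [hz h₁, hz h₂, zero_mul, mul_zero]
    · rfl
    · exact (link h).symm
    · have hm : U p m ≠ 0 := (hs p m).2 h₂.1
      refine mul_right_cancel₀ hm ?_
      linear_combination -U p j * link h₁ - U p j₀ * link h₂
  have h₁ := horth p q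
  have h₂ := horth q q
  rw [if_neg hpq] at h₁
  rw [if_pos rfl] at h₂
  -- Proportionality turns `U p j₀` times the norm of row `q` into `U q j₀` times the inner product
  -- of rows `p` and `q`, which vanishes.
  have : U p j₀ = 0 := by
    calc U p j₀ = U p j₀ * ∑ j, U q j * star (U q j) := by rw [h₂, mul_one]
      _ = U q j₀ * ∑ j, U p j * star (U q j) := by
        rw [Finset.mul_sum, Finset.mul_sum]
        exact Finset.sum_congr rfl fun j _ => by linear_combination -star (U q j) * hprop j
      _ = 0 := by rw [h₁, mul_zero]
  exact (hs p j₀).2 hp this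

/-! ### Entries -/

/-- Decision procedure for the printed data, apart from the indices `T` and `N`. -/
def Entry.check (e : Entry n) : Bool :=
  Nat.beq (autB n (rowCodes e.mat)) e.aut && regB n (rowCodes e.mat) == e.idxR &&
    symB n (rowCodes e.mat) == e.idxS && e.idxT == !e.idxS

/-- The index T needs no test of its own. A marked matrix appears in the expanded list beside its
transpose, and members of that list are pairwise inequivalent. An unmarked one carries S by the
check, and a matrix equivalent to a symmetric one is equivalent to its transpose. -/
theorem Entry.correct_of_check (hn : 0 < n) (hn' : n ≤ 6) {L : List (Entry n)}
    (hz : ∀ A ∈ expand L, IsZeroOne A) (hL : (expand L).Pairwise fun A B => ¬ Equivalent A B)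
    (hc : L.all Entry.check = true) (hN : ∀ e ∈ L, e.idxN = true → HasLinkedRows fun i j => e.mat i j) :
    ∀ e ∈ L, e.Correct := by
  intro e he
  have hmem : e.mat ∈ expand L :=
    List.mem_flatMap.2 ⟨e, he, by split_ifs <;> simp⟩
  have hM := hz _ hmem
  have := List.all_eq_true.1 hc e he
  simp only [Entry.check, Bool.and_eq_true, beq_iff_eq, Nat.beq_eq] at this
  obtain ⟨⟨⟨h₁, h₂⟩, h₃⟩, h₄⟩ := this
  have hS : e.idxS = true ↔ ∃ A : Matrix (Fin n) (Fin n) ℕ, A.IsSymm ∧ Equivalent e.mat A := by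
    rw [← h₃, symB_iff hM]
  refine ⟨(autOrder_eq hn' hM.le_one).trans h₁, by rw [← h₂, regB_iff hn hn' hM], hS, ⟨?_, ?_⟩,
    fun h => (hN e he h : HasLinkedRows e.mat).not_supportsUnitary⟩
  · intro hT
    have := (List.pairwise_flatMap.1 hL).1 e he
    rw [if_pos hT] at this
    simpa using this
  · intro hT
    by_contra hT'
    rw [h₄, Bool.not_eq_true, Bool.not_eq_false', hS] at hT'
    obtain ⟨A, hA, e₁⟩ := hT'
    refine hT (equivalent_trans e₁ ?_)
    obtain ⟨σ, τ, rfl⟩ := equivalent_iff.1 e₁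
    rw [← hA.eq]
    exact equivalent_symm (equivalent_iff.2 ⟨τ, σ, rfl⟩)

/-! ### Standard Young tableaux -/

/-- The cells of the Young diagram with row lengths `t.1, t.2.1, t.2.2`. -/
def shapeCells (t : ℕ × ℕ × ℕ) : Finset (ℕ × ℕ) :=
  {0} ×ˢ Finset.range t.1 ∪ {1} ×ˢ Finset.range t.2.1 ∪ {2} ×ˢ Finset.range t.2.2

theorem mem_shapeCells {t : ℕ × ℕ × ℕ} {x : ℕ × ℕ} : x ∈ shapeCells t ↔
    x.1 = 0 ∧ x.2 < t.1 ∨ x.1 = 1 ∧ x.2 < t.2.1 ∨ x.1 = 2 ∧ x.2 < t.2.2 := by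
  simp only [shapeCells, Finset.mem_union, Finset.mem_product, Finset.mem_singleton,
    Finset.mem_range, or_assoc]

theorem card_shapeCells (t : ℕ × ℕ × ℕ) : (shapeCells t).card = t.1 + t.2.1 + t.2.2 := by
  rw [shapeCells, Finset.card_union_of_disjoint, Finset.card_union_of_disjoint]
  · simp
  · simp [Finset.disjoint_left]
  · simp only [Finset.disjoint_left, Finset.mem_union, Finset.mem_product, Finset.mem_singleton]
    omega

/-- The partitions of `m` into at most three parts. -/
def shapes (m : ℕ) : Finset (ℕ × ℕ × ℕ) :=
  (Finset.range (m + 1) ×ˢ Finset.range (m + 1) ×ˢ Finset.range (m + 1)).filter fun t =>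
    t.2.1 ≤ t.1 ∧ t.2.2 ≤ t.2.1 ∧ t.1 + t.2.1 + t.2.2 = m

theorem mem_shapes {m : ℕ} {t : ℕ × ℕ × ℕ} :
    t ∈ shapes m ↔ t.2.1 ≤ t.1 ∧ t.2.2 ≤ t.2.1 ∧ t.1 + t.2.1 + t.2.2 = m := by
  simp only [shapes, Finset.mem_filter, Finset.mem_product, Finset.mem_range]
  omega

/-- The first three row lengths of a Young diagram. -/
def rowLens₃ (μ : YoungDiagram) : ℕ × ℕ × ℕ := (μ.rowLen 0, μ.rowLen 1, μ.rowLen 2)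

theorem cells_eq_shapeCells {μ : YoungDiagram} (h : μ.colLen 0 ≤ 3) :
    μ.cells = shapeCells (rowLens₃ μ) := by
  ext ⟨i, j⟩
  rw [mem_shapeCells, YoungDiagram.mem_cells, YoungDiagram.mem_iff_lt_rowLen]
  simp only [rowLens₃]
  constructor
  · intro hj
    have hi : i < 3 := by
      refine lt_of_lt_of_le ?_ h
      rw [← YoungDiagram.mem_iff_lt_colLen, YoungDiagram.mem_iff_lt_rowLen]
      omega
    interval_cases i <;> simp [hj]
  · rintro (⟨rfl, h⟩ | ⟨rfl, h⟩ | ⟨rfl, h⟩) <;> exact h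

/-- The Young diagram with the given row lengths. -/
def shapeDiagram (t : ℕ × ℕ × ℕ) (h₁ : t.2.1 ≤ t.1) (h₂ : t.2.2 ≤ t.2.1) : YoungDiagram where
  cells := shapeCells t
  isLowerSet := by
    rintro ⟨i, j⟩ ⟨i', j'⟩ ⟨hi, hj⟩ hx
    simp only [Finset.mem_coe, mem_shapeCells] at hx ⊢
    simp only at hi hj
    omega

theorem rowLens₃_shapeDiagram (t : ℕ × ℕ × ℕ) (h₁ : t.2.1 ≤ t.1) (h₂ : t.2.2 ≤ t.2.1) :
    rowLens₃ (shapeDiagram t h₁ h₂) = t := by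
  have h : ∀ i j, j < (shapeDiagram t h₁ h₂).rowLen i ↔ (i, j) ∈ shapeCells t := fun i j =>
    YoungDiagram.mem_iff_lt_rowLen.symm
  simp only [mem_shapeCells] at h
  refine Prod.ext ?_ (Prod.ext ?_ ?_)
  · exact eq_of_forall_lt_iff fun j => by simpa [rowLens₃] using h 0 j
  · exact eq_of_forall_lt_iff fun j => by simpa [rowLens₃] using h 1 j
  · exact eq_of_forall_lt_iff fun j => by simpa [rowLens₃] using h 2 j

/-- Young diagrams with at most three rows correspond to partitions into at most three parts. -/
noncomputable def shapesEquiv (m : ℕ) :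
    {μ : YoungDiagram // μ.card = m ∧ μ.colLen 0 ≤ 3} ≃ shapes m where
  toFun μ := ⟨rowLens₃ μ.1, mem_shapes.2 ⟨μ.1.rowLen_anti _ _ (by norm_num),
    μ.1.rowLen_anti _ _ (by norm_num), by
      rw [← card_shapeCells, ← cells_eq_shapeCells μ.2.2]; exact μ.2.1⟩⟩
  invFun t := ⟨shapeDiagram t.1 (mem_shapes.1 t.2).1 (mem_shapes.1 t.2).2.1,
    (card_shapeCells t.1).trans (mem_shapes.1 t.2).2.2, by
      -- A first column of length above 3 would contain the cell `(3, 0)`, which no shape with three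
      -- rows has.
      by_contra h
      push Not at h
      have := YoungDiagram.mem_iff_lt_colLen.2 h
      have := mem_shapeCells.1 (show ((3, 0) : ℕ × ℕ) ∈ shapeCells t.1 from this)
      simp at this⟩
  left_inv μ := Subtype.ext (YoungDiagram.ext (cells_eq_shapeCells μ.2.2).symm)
  right_inv t := Subtype.ext (rowLens₃_shapeDiagram t.1 (mem_shapes.1 t.2).1 (mem_shapes.1 t.2).2.1)

/-- A decidable form of strict monotonicity. -/
instance {m : ℕ} (s : Finset (ℕ × ℕ)) (T : s ≃ Fin m) : Decidable (StrictMono T) :=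
  decidable_of_iff (∀ x y : s, (x.1.1 ≤ y.1.1 ∧ x.1.2 ≤ y.1.2) → x ≠ y → T x < T y)
    ⟨fun h _ _ hxy => h _ _ hxy.le hxy.ne, fun h _ _ hxy hne => h (lt_of_le_of_ne hxy hne)⟩

/-- Replacing Young diagrams by explicit triples of row lengths makes the index set finite and
enumerable; for each shape the triples of tableaux are counted by a cube. -/
theorem numTableauTriples_eq (m : ℕ) : numTableauTriples m =
    ∑ t ∈ shapes m, Fintype.card {T : shapeCells t ≃ Fin m // StrictMono T} ^ 3 := by
  let e : (Σ μ : {μ : YoungDiagram // μ.card = m ∧ μ.colLen 0 ≤ 3},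
      (Fin 3 → {T : μ.1.cells ≃ Fin m // StrictMono T})) ≃
      Σ t : shapes m, (Fin 3 → {T : shapeCells t ≃ Fin m // StrictMono T}) :=
    (shapesEquiv m).sigmaCongr fun μ => Equiv.cast
      (congrArg (fun s : Finset (ℕ × ℕ) => Fin 3 → {T : s ≃ Fin m // StrictMono T})
        (cells_eq_shapeCells μ.2.2))
  rw [numTableauTriples, Nat.card_congr e, Nat.card_eq_fintype_card, Fintype.card_sigma]
  simp only [Fintype.card_fun, Fintype.card_fin]
  exact Finset.sum_coe_sort (shapes m) fun t =>
    Fintype.card {T : shapeCells t ≃ Fin m // StrictMono T} ^ 3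

theorem numTableauTriples_values (k : Fin 5) : numTableauTriples k.val = ![1, 1, 2, 10, 63] k := by
  rw [numTableauTriples_eq]
  revert k
  decide +kernel

/-! ### The lists -/

/-- The decomposable SQ matrices of degree 2. -/
def decomp2 : List (Matrix (Fin 2) (Fin 2) ℕ) :=
  [!![1, 0; 0, 1]]

/-- The decomposable SQ matrices of degree 3. -/
def decomp3 : List (Matrix (Fin 3) (Fin 3) ℕ) :=
  [!![1, 1, 0; 1, 1, 0; 0, 0, 1],
   !![1, 0, 0; 0, 1, 0; 0, 0, 1]]

/-- The decomposable SQ matrices of degree 4. -/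
def decomp4 : List (Matrix (Fin 4) (Fin 4) ℕ) :=
  [!![0, 1, 1, 0; 1, 1, 1, 0; 1, 1, 1, 0; 0, 0, 0, 1],
   !![1, 1, 1, 0; 1, 1, 1, 0; 1, 1, 1, 0; 0, 0, 0, 1],
   !![1, 1, 0, 0; 1, 1, 0, 0; 0, 0, 1, 1; 0, 0, 1, 1],
   !![1, 1, 0, 0; 1, 1, 0, 0; 0, 0, 1, 0; 0, 0, 0, 1],
   !![1, 0, 0, 0; 0, 1, 0, 0; 0, 0, 1, 0; 0, 0, 0, 1]]

/-- The decomposable SQ matrices of degree 5. -/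
def decomp5 : List (Matrix (Fin 5) (Fin 5) ℕ) :=
  [!![0, 1, 1, 1, 0; 1, 1, 1, 1, 0; 1, 1, 1, 1, 0; 1, 1, 1, 1, 0; 0, 0, 0, 0, 1],
   !![0, 1, 1, 1, 0; 1, 0, 1, 1, 0; 1, 1, 1, 1, 0; 1, 1, 1, 1, 0; 0, 0, 0, 0, 1],
   !![0, 1, 1, 1, 0; 1, 0, 1, 1, 0; 1, 1, 0, 1, 0; 1, 1, 1, 1, 0; 0, 0, 0, 0, 1],
   !![0, 1, 1, 1, 0; 1, 0, 1, 1, 0; 1, 1, 0, 1, 0; 1, 1, 1, 0, 0; 0, 0, 0, 0, 1],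
   !![0, 0, 1, 1, 0; 0, 1, 1, 1, 0; 1, 1, 1, 1, 0; 1, 1, 1, 1, 0; 0, 0, 0, 0, 1],
   !![0, 0, 1, 1, 0; 1, 1, 1, 1, 0; 1, 1, 1, 1, 0; 1, 1, 1, 1, 0; 0, 0, 0, 0, 1],
   !![0, 1, 1, 1, 0; 0, 1, 1, 1, 0; 1, 1, 1, 1, 0; 1, 1, 1, 1, 0; 0, 0, 0, 0, 1],
   !![1, 0, 1, 1, 0; 0, 1, 1, 1, 0; 1, 0, 1, 1, 0; 0, 1, 1, 1, 0; 0, 0, 0, 0, 1],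
   !![1, 0, 1, 0, 0; 0, 1, 0, 1, 0; 1, 1, 1, 1, 0; 1, 1, 1, 1, 0; 0, 0, 0, 0, 1],
   !![1, 1, 1, 1, 0; 1, 1, 1, 1, 0; 1, 1, 1, 1, 0; 1, 1, 1, 1, 0; 0, 0, 0, 0, 1],
   !![0, 1, 1, 0, 0; 1, 1, 1, 0, 0; 1, 1, 1, 0, 0; 0, 0, 0, 1, 1; 0, 0, 0, 1, 1],
   !![1, 1, 1, 0, 0; 1, 1, 1, 0, 0; 1, 1, 1, 0, 0; 0, 0, 0, 1, 1; 0, 0, 0, 1, 1],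
   !![0, 1, 1, 0, 0; 1, 1, 1, 0, 0; 1, 1, 1, 0, 0; 0, 0, 0, 1, 0; 0, 0, 0, 0, 1],
   !![1, 1, 1, 0, 0; 1, 1, 1, 0, 0; 1, 1, 1, 0, 0; 0, 0, 0, 1, 0; 0, 0, 0, 0, 1],
   !![1, 1, 0, 0, 0; 1, 1, 0, 0, 0; 0, 0, 1, 1, 0; 0, 0, 1, 1, 0; 0, 0, 0, 0, 1],
   !![1, 1, 0, 0, 0; 1, 1, 0, 0, 0; 0, 0, 1, 0, 0; 0, 0, 0, 1, 0; 0, 0, 0, 0, 1],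
   !![1, 0, 0, 0, 0; 0, 1, 0, 0, 0; 0, 0, 1, 0, 0; 0, 0, 0, 1, 0; 0, 0, 0, 0, 1]]

/-- From the decidable checks of a list of indecomposable entries and a list of decomposable
matrices to the classification. -/
theorem classification (hn : 0 < n) (hn' : n ≤ 6) {L : List (Entry n)}
    {D : List (Matrix (Fin n) (Fin n) ℕ)} (hz : ∀ A ∈ expand L ++ D, IsZeroOne A)
    (hsq : ((expand L ++ D).all fun A => sqB n (rowCodes A)) = true)
    (hinv : ((expand L ++ D).map fun A => classInvariant n (rowCodes A)).Pairwise (· ≠ ·))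
    (hs : searchSQ n (allCodes n) (fun _ _ => true)
      ((expand L ++ D).map fun A => colKey n (rowCodes A)) = true)
    (hL : ((expand L).all fun A => indecB n (rowCodes A)) = true)
    (hD : (D.all fun A => !indecB n (rowCodes A)) = true)
    (hc : L.all Entry.check = true) (hN : ∀ e ∈ L, e.idxN = true → HasLinkedRows fun i j => e.mat i j) :
    IsCompleteList IsSQ (expand L ++ D) ∧
      IsCompleteList (fun M => IsSQ M ∧ IsIndecomposable M) (expand L) ∧
        ∀ e ∈ L, e.Correct := by
  have h := isCompleteList_isSQ hn' hz hsq hinv hs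
  have h' := h.and_of_append
    (fun A hA => (indecB_iff hn' (hz A (List.mem_append_left _ hA))).1
      (List.all_eq_true.1 hL A hA))
    (fun A hA hi => by
      have := List.all_eq_true.1 hD A hA
      rw [(indecB_iff hn' (hz A (List.mem_append_right _ hA))).2 hi] at this
      exact Bool.false_ne_true this)
    IsIndecomposable.of_equivalent
  exact ⟨h, h', Entry.correct_of_check hn hn' (fun A hA => hz A (List.mem_append_left _ hA))
    h'.2.1 hc hN⟩

/-! ### Evaluation of the tests in degrees one to five -/

theorem zeroOne₁ : ∀ A ∈ expand list1 ++ [], IsZeroOne A := by decide +kernel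

theorem zeroOne₂ : ∀ A ∈ expand list2 ++ decomp2, IsZeroOne A := by decide +kernel

theorem zeroOne₃ : ∀ A ∈ expand list3 ++ decomp3, IsZeroOne A := by decide +kernel

theorem zeroOne₄ : ∀ A ∈ expand list4 ++ decomp4, IsZeroOne A := by decide +kernel

theorem zeroOne₅ : ∀ A ∈ expand list5 ++ decomp5, IsZeroOne A := by decide +kernel

theorem classification₁ : IsCompleteList IsSQ (expand list1 ++ []) ∧
    IsCompleteList (fun M => IsSQ M ∧ IsIndecomposable M) (expand list1) ∧
      ∀ e ∈ list1, e.Correct := by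
  refine classification (by norm_num) (by norm_num) zeroOne₁ ?_ ?_ ?_ ?_ ?_ ?_ ?_ <;>
    decide +kernel

theorem classification₂ : IsCompleteList IsSQ (expand list2 ++ decomp2) ∧
    IsCompleteList (fun M => IsSQ M ∧ IsIndecomposable M) (expand list2) ∧
      ∀ e ∈ list2, e.Correct := by
  refine classification (by norm_num) (by norm_num) zeroOne₂ ?_ ?_ ?_ ?_ ?_ ?_ ?_ <;>
    decide +kernel

theorem classification₃ : IsCompleteList IsSQ (expand list3 ++ decomp3) ∧
    IsCompleteList (fun M => IsSQ M ∧ IsIndecomposable M) (expand list3) ∧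
      ∀ e ∈ list3, e.Correct := by
  refine classification (by norm_num) (by norm_num) zeroOne₃ ?_ ?_ ?_ ?_ ?_ ?_ ?_ <;>
    decide +kernel

theorem classification₄ : IsCompleteList IsSQ (expand list4 ++ decomp4) ∧
    IsCompleteList (fun M => IsSQ M ∧ IsIndecomposable M) (expand list4) ∧
      ∀ e ∈ list4, e.Correct := by
  refine classification (by norm_num) (by norm_num) zeroOne₄ ?_ ?_ ?_ ?_ ?_ ?_ ?_ <;>
    decide +kernel

theorem all_sqB₅ : ((expand list5 ++ decomp5).all fun A => sqB 5 (rowCodes A)) = true := by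
  decide +kernel

theorem pairwise_classInvariant₅ :
    ((expand list5 ++ decomp5).map fun A => classInvariant 5 (rowCodes A)).Pairwise (· ≠ ·) := by
  decide +kernel

theorem searchSQ₅ : searchSQ 5 (allCodes 5) (fun _ _ => true)
    ((expand list5 ++ decomp5).map fun A => colKey 5 (rowCodes A)) = true := by
  decide +kernel

theorem all_check₅ : list5.all Entry.check = true := by
  decide +kernel

theorem classification₅ : IsCompleteList IsSQ (expand list5 ++ decomp5) ∧
    IsCompleteList (fun M => IsSQ M ∧ IsIndecomposable M) (expand list5) ∧
      ∀ e ∈ list5, e.Correct := by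
  refine classification (by norm_num) (by norm_num) zeroOne₅ all_sqB₅ pairwise_classInvariant₅
    searchSQ₅ ?_ ?_ all_check₅ ?_ <;>
    decide +kernel

/-! ### Regular matrices of degree six -/

/-- The indecomposable regular SQ matrices of degree 6. -/
def regularIndec6 : List (Matrix (Fin 6) (Fin 6) ℕ) :=
  allOnes 6 :: (allOnes 6 - 1) :: expand list6

/-- The decomposable regular SQ matrices of degree 6. -/
def regularDecomp6 : List (Matrix (Fin 6) (Fin 6) ℕ) :=
  [blockOnes 3, blockOnes 2, 1]

theorem zeroOne₆ : ∀ A ∈ regularIndec6 ++ regularDecomp6, IsZeroOne A := by decide +kernel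

theorem pairwise₆ : (regularIndec6 ++ regularDecomp6).Pairwise fun A B => ¬ Equivalent A B :=
  pairwise_not_equivalent le_rfl zeroOne₆ (by decide +kernel)

theorem all_sqB₆ :
    ((regularIndec6 ++ regularDecomp6).all fun A => sqB 6 (rowCodes A)) = true := by
  decide +kernel

/-- Each list is the part of one common list with row sum `w`, so strong quadrangularity and
inequivalence are checked once for all `w`; only the search is specific. -/
theorem isCompleteList_regular₆ {w : ℕ} {L : List (Matrix (Fin 6) (Fin 6) ℕ)}
    (hL : L = (regularIndec6 ++ regularDecomp6).filter fun A => regOfB 6 w (rowCodes A))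
    (hs : searchSQ 6 ((allCodes 6).filter (· % 63 == w)) (colSums 6 w)
      (L.map fun A => colKey 6 (rowCodes A)) = true) :
    IsCompleteList (fun M => IsSQ M ∧ IsRegularOf w M) L := by
  have sub : L.Sublist (regularIndec6 ++ regularDecomp6) := hL ▸ List.filter_sublist
  refine isCompleteList_isRegularOf le_rfl (fun A hA => zeroOne₆ A (sub.subset hA))
    (List.all_eq_true.2 fun A hA => List.all_eq_true.1 all_sqB₆ A (sub.subset hA)) ?_
    (pairwise₆.sublist sub) hs
  subst hL
  exact List.all_eq_true.2 fun A hA => (List.mem_filter.1 hA).2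

theorem isCompleteList_six :
    IsCompleteList (fun M => IsSQ M ∧ IsRegularOf 6 M) [allOnes 6] := by
  apply isCompleteList_regular₆ <;> decide +kernel

theorem isCompleteList_five :
    IsCompleteList (fun M => IsSQ M ∧ IsRegularOf 5 M) [allOnes 6 - 1] := by
  apply isCompleteList_regular₆ <;> decide +kernel

theorem isCompleteList_four :
    IsCompleteList (fun M => IsSQ M ∧ IsRegularOf 4 M) (expand list6) := by
  apply isCompleteList_regular₆ <;> decide +kernel

theorem isCompleteList_three :
    IsCompleteList (fun M => IsSQ M ∧ IsRegularOf 3 M) [blockOnes 3] := by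
  apply isCompleteList_regular₆ <;> decide +kernel

theorem isCompleteList_two :
    IsCompleteList (fun M => IsSQ M ∧ IsRegularOf 2 M) [blockOnes 2] := by
  apply isCompleteList_regular₆ <;> decide +kernel

theorem isCompleteList_one : IsCompleteList
    (fun M : Matrix (Fin 6) (Fin 6) ℕ => IsSQ M ∧ IsRegularOf 1 M) [1] := by
  apply isCompleteList_regular₆ <;> decide +kernel

theorem correct₆ : ∀ e ∈ list6, e.Correct := by
  have sub : (expand list6).Sublist (regularIndec6 ++ regularDecomp6) :=
    ((List.sublist_cons_self _ _).trans (List.sublist_cons_self _ _)).trans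
      (List.sublist_append_left _ _)
  refine Entry.correct_of_check (by norm_num) le_rfl (fun A hA => zeroOne₆ A (sub.subset hA))
    (pairwise₆.sublist sub) ?_ ?_ <;> decide +kernel

theorem isCompleteList_isRegular₆ :
    IsCompleteList (fun M => IsSQ M ∧ IsRegular M) (regularIndec6 ++ regularDecomp6) := by
  have hr : ((regularIndec6 ++ regularDecomp6).all fun A => regB 6 (rowCodes A)) = true := by
    decide +kernel
  refine ⟨fun A hA => ⟨(sqB_iff le_rfl (zeroOne₆ A hA)).1 (List.all_eq_true.1 all_sqB₆ A hA),
    (regB_iff (by norm_num) le_rfl (zeroOne₆ A hA)).1 (List.all_eq_true.1 hr A hA)⟩,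
    pairwise₆, ?_⟩
  rintro M ⟨hM, k, hk⟩
  have h₁ : k ≤ 6 := hk.1 0 ▸ hM.1.1.sum_row_le 0
  -- Row sum 0 would give a zero row, so only the six sums already classified remain.
  have h₂ : k ≠ 0 := by
    rintro rfl
    obtain ⟨j, hj⟩ := hM.2.1 0
    exact hj (Finset.sum_eq_zero_iff.1 (hk.1 0) j (Finset.mem_univ j))
  have key : ∀ {L : List (Matrix (Fin 6) (Fin 6) ℕ)}, L ⊆ regularIndec6 ++ regularDecomp6 →
      (∃ A ∈ L, Equivalent M A) → ∃ A ∈ regularIndec6 ++ regularDecomp6, Equivalent M A :=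
    fun hL ⟨A, hA, e⟩ => ⟨A, hL hA, e⟩
  simp only [regularIndec6, regularDecomp6, List.cons_append] at key ⊢
  interval_cases k
  · exact absurd rfl h₂
  · exact key (by simp) (isCompleteList_one.2.2 M ⟨hM, hk⟩)
  · exact key (by simp) (isCompleteList_two.2.2 M ⟨hM, hk⟩)
  · exact key (by simp) (isCompleteList_three.2.2 M ⟨hM, hk⟩)
  · exact key (fun A hA => by simp [hA]) (isCompleteList_four.2.2 M ⟨hM, hk⟩)
  · exact key (by simp) (isCompleteList_five.2.2 M ⟨hM, hk⟩)
  · exact key (by simp) (isCompleteList_six.2.2 M ⟨hM, hk⟩)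

theorem isCompleteList_isIndecomposable₆ : IsCompleteList
    (fun M => (IsSQ M ∧ IsRegular M) ∧ IsIndecomposable M) regularIndec6 := by
  have h₁ : (regularIndec6.all fun A => indecB 6 (rowCodes A)) = true := by decide +kernel
  have h₂ : (regularDecomp6.all fun A => !indecB 6 (rowCodes A)) = true := by decide +kernel
  refine isCompleteList_isRegular₆.and_of_append (fun A hA => ?_) (fun A hA hi => ?_)
    IsIndecomposable.of_equivalent
  · exact (indecB_iff le_rfl (zeroOne₆ A (List.mem_append_left _ hA))).1
      (List.all_eq_true.1 h₁ A hA)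
  · have := List.all_eq_true.1 h₂ A hA
    rw [(indecB_iff le_rfl (zeroOne₆ A (List.mem_append_right _ hA))).2 hi] at this
    exact Bool.false_ne_true this

/-! ### Numbers of classes -/

theorem numClasses_indecomposable (k : Fin 5) :
    numClasses (n := k.val + 1) (fun M => IsSQ M ∧ IsIndecomposable M) = ![1, 1, 2, 10, 63] k := by
  fin_cases k
  · exact classification₁.2.1.numClasses_eq_length
  · exact classification₂.2.1.numClasses_eq_length
  · exact classification₃.2.1.numClasses_eq_length
  · exact classification₄.2.1.numClasses_eq_length
  · exact classification₅.2.1.numClasses_eq_length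

theorem numClasses_isSQ (k : Fin 5) :
    numClasses (n := k.val + 1) (fun M => IsSQ M) = ![1, 2, 4, 15, 80] k := by
  fin_cases k
  · exact classification₁.1.numClasses_eq_length
  · exact classification₂.1.numClasses_eq_length
  · exact classification₃.1.numClasses_eq_length
  · exact classification₄.1.numClasses_eq_length
  · exact classification₅.1.numClasses_eq_length

theorem isSQ_and_isIndecomposable_of_equivalent {n : ℕ} {M N : Matrix (Fin n) (Fin n) ℕ}
    (h : IsSQ M ∧ IsIndecomposable M) (e : Equivalent M N) : IsSQ N ∧ IsIndecomposable N :=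
  ⟨h.1.of_equivalent e, h.2.of_equivalent e⟩

theorem numClasses_indecomposable_isSymm (k : Fin 5) :
    numClasses (n := k.val + 1) (fun M => IsSQ M ∧ IsIndecomposable M ∧ M.IsSymm) =
      ![1, 1, 2, 6, 23] k := by
  simp only [← and_assoc]
  fin_cases k
  · exact (classification₁.2.1.numClasses_and_isSymm
      (fun A hA => zeroOne₁ A (List.mem_append_left _ hA))
      isSQ_and_isIndecomposable_of_equivalent).trans (by decide +kernel)
  · exact (classification₂.2.1.numClasses_and_isSymm
      (fun A hA => zeroOne₂ A (List.mem_append_left _ hA))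
      isSQ_and_isIndecomposable_of_equivalent).trans (by decide +kernel)
  · exact (classification₃.2.1.numClasses_and_isSymm
      (fun A hA => zeroOne₃ A (List.mem_append_left _ hA))
      isSQ_and_isIndecomposable_of_equivalent).trans (by decide +kernel)
  · exact (classification₄.2.1.numClasses_and_isSymm
      (fun A hA => zeroOne₄ A (List.mem_append_left _ hA))
      isSQ_and_isIndecomposable_of_equivalent).trans (by decide +kernel)
  · exact (classification₅.2.1.numClasses_and_isSymm
      (fun A hA => zeroOne₅ A (List.mem_append_left _ hA))
      isSQ_and_isIndecomposable_of_equivalent).trans (by decide +kernel)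

theorem numClasses_isSymm (k : Fin 5) :
    numClasses (n := k.val + 1) (fun M => IsSQ M ∧ M.IsSymm) = ![1, 2, 4, 11, 36] k := by
  fin_cases k
  · exact (classification₁.1.numClasses_and_isSymm zeroOne₁ IsSQ.of_equivalent).trans
      (by decide +kernel)
  · exact (classification₂.1.numClasses_and_isSymm zeroOne₂ IsSQ.of_equivalent).trans
      (by decide +kernel)
  · exact (classification₃.1.numClasses_and_isSymm zeroOne₃ IsSQ.of_equivalent).trans
      (by decide +kernel)
  · exact (classification₄.1.numClasses_and_isSymm zeroOne₄ IsSQ.of_equivalent).trans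
      (by decide +kernel)
  · exact (classification₅.1.numClasses_and_isSymm zeroOne₅ IsSQ.of_equivalent).trans
      (by decide +kernel)

theorem numClasses_indecomposable_isRegular (k : Fin 6) :
    numClasses (n := k.val + 1) (fun M => IsSQ M ∧ IsIndecomposable M ∧ IsRegular M) =
      ![1, 1, 1, 2, 2, 6] k := by
  fin_cases k <;> simp only [← and_assoc]
  · exact (classification₁.2.1.numClasses_and_isRegular (by norm_num) (by norm_num)
      fun A hA => zeroOne₁ A (List.mem_append_left _ hA)).trans (by decide +kernel)
  · exact (classification₂.2.1.numClasses_and_isRegular (by norm_num) (by norm_num)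
      fun A hA => zeroOne₂ A (List.mem_append_left _ hA)).trans (by decide +kernel)
  · exact (classification₃.2.1.numClasses_and_isRegular (by norm_num) (by norm_num)
      fun A hA => zeroOne₃ A (List.mem_append_left _ hA)).trans (by decide +kernel)
  · exact (classification₄.2.1.numClasses_and_isRegular (by norm_num) (by norm_num)
      fun A hA => zeroOne₄ A (List.mem_append_left _ hA)).trans (by decide +kernel)
  · exact (classification₅.2.1.numClasses_and_isRegular (by norm_num) (by norm_num)
      fun A hA => zeroOne₅ A (List.mem_append_left _ hA)).trans (by decide +kernel)
  · have := isCompleteList_isIndecomposable₆.numClasses_eq_length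
    simp only [and_right_comm] at this
    exact this

theorem numClasses_isRegular (k : Fin 6) :
    numClasses (n := k.val + 1) (fun M => IsSQ M ∧ IsRegular M) = ![1, 2, 2, 4, 3, 9] k := by
  fin_cases k
  · exact (classification₁.1.numClasses_and_isRegular (by norm_num) (by norm_num)
      zeroOne₁).trans (by decide +kernel)
  · exact (classification₂.1.numClasses_and_isRegular (by norm_num) (by norm_num)
      zeroOne₂).trans (by decide +kernel)
  · exact (classification₃.1.numClasses_and_isRegular (by norm_num) (by norm_num)
      zeroOne₃).trans (by decide +kernel)
  · exact (classification₄.1.numClasses_and_isRegular (by norm_num) (by norm_num)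
      zeroOne₄).trans (by decide +kernel)
  · exact (classification₅.1.numClasses_and_isRegular (by norm_num) (by norm_num)
      zeroOne₅).trans (by decide +kernel)
  · exact isCompleteList_isRegular₆.numClasses_eq_length

end SQ

theorem mainTheorem5 :
    -- the lists of all indecomposable SQ matrices of degree at most 5, with their indices
    (SQ.IsCompleteList (fun M => SQ.IsSQ M ∧ SQ.IsIndecomposable M) (SQ.expand SQ.list1) ∧
      ∀ e ∈ SQ.list1, e.Correct) ∧
    (SQ.IsCompleteList (fun M => SQ.IsSQ M ∧ SQ.IsIndecomposable M) (SQ.expand SQ.list2) ∧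
      ∀ e ∈ SQ.list2, e.Correct) ∧
    (SQ.IsCompleteList (fun M => SQ.IsSQ M ∧ SQ.IsIndecomposable M) (SQ.expand SQ.list3) ∧
      ∀ e ∈ SQ.list3, e.Correct) ∧
    (SQ.IsCompleteList (fun M => SQ.IsSQ M ∧ SQ.IsIndecomposable M) (SQ.expand SQ.list4) ∧
      ∀ e ∈ SQ.list4, e.Correct) ∧
    (SQ.IsCompleteList (fun M => SQ.IsSQ M ∧ SQ.IsIndecomposable M) (SQ.expand SQ.list5) ∧
      ∀ e ∈ SQ.list5, e.Correct) ∧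
    -- the regular SQ matrices of degree 6, by the number of ones in each row
    SQ.IsCompleteList (fun M => SQ.IsSQ M ∧ SQ.IsRegularOf 6 M) [SQ.allOnes 6] ∧
    SQ.IsCompleteList (fun M => SQ.IsSQ M ∧ SQ.IsRegularOf 5 M) [SQ.allOnes 6 - 1] ∧
    (SQ.IsCompleteList (fun M => SQ.IsSQ M ∧ SQ.IsRegularOf 4 M) (SQ.expand SQ.list6) ∧
      ∀ e ∈ SQ.list6, e.Correct) ∧
    SQ.IsCompleteList (fun M => SQ.IsSQ M ∧ SQ.IsRegularOf 3 M) [SQ.blockOnes 3] ∧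
    SQ.IsCompleteList (fun M => SQ.IsSQ M ∧ SQ.IsRegularOf 2 M) [SQ.blockOnes 2] ∧
    SQ.IsCompleteList (fun M : Matrix (Fin 6) (Fin 6) ℕ => SQ.IsSQ M ∧ SQ.IsRegularOf 1 M) [1] ∧
    -- the numbers of inequivalent matrices of degree `k + 1`
    (∀ k : Fin 5, SQ.numClasses (n := k.val + 1) (fun M => SQ.IsSQ M ∧ SQ.IsIndecomposable M) =
      ![1, 1, 2, 10, 63] k) ∧
    (∀ k : Fin 5, SQ.numClasses (n := k.val + 1) (fun M => SQ.IsSQ M ∧ SQ.IsIndecomposable M) =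
      SQ.numTableauTriples k.val) ∧
    (∀ k : Fin 5, SQ.numClasses (n := k.val + 1) (fun M => SQ.IsSQ M) = ![1, 2, 4, 15, 80] k) ∧
    (∀ k : Fin 5, SQ.numClasses (n := k.val + 1)
      (fun M => SQ.IsSQ M ∧ SQ.IsIndecomposable M ∧ M.IsSymm) = ![1, 1, 2, 6, 23] k) ∧
    (∀ k : Fin 5, SQ.numClasses (n := k.val + 1) (fun M => SQ.IsSQ M ∧ M.IsSymm) =
      ![1, 2, 4, 11, 36] k) ∧
    (∀ k : Fin 6, SQ.numClasses (n := k.val + 1)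
      (fun M => SQ.IsSQ M ∧ SQ.IsIndecomposable M ∧ SQ.IsRegular M) = ![1, 1, 1, 2, 2, 6] k) ∧
    (∀ k : Fin 6, SQ.numClasses (n := k.val + 1) (fun M => SQ.IsSQ M ∧ SQ.IsRegular M) =
      ![1, 2, 2, 4, 3, 9] k) := by
  exact ⟨SQ.classification₁.2, SQ.classification₂.2, SQ.classification₃.2, SQ.classification₄.2,
    SQ.classification₅.2, SQ.isCompleteList_six, SQ.isCompleteList_five,
    ⟨SQ.isCompleteList_four, SQ.correct₆⟩, SQ.isCompleteList_three, SQ.isCompleteList_two,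
    SQ.isCompleteList_one, SQ.numClasses_indecomposable,
    fun k => (SQ.numClasses_indecomposable k).trans (SQ.numTableauTriples_values k).symm,
    SQ.numClasses_isSQ, SQ.numClasses_indecomposable_isSymm, SQ.numClasses_isSymm,
    SQ.numClasses_indecomposable_isRegular, SQ.numClasses_isRegular⟩
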